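/- Let $G_{\mathbb C}$ be a connected complex Lie group whose Lie algebra $\mathfrak g_{\mathbb C}$ is a finite-dimensional complex simple Lie algebra, let $\theta$ be a holomorphic automorphism of $G_{\mathbb C}$ with $\theta^2=\mathrm{id}$, and let $K_{\mathbb C}$ be a subgroup with $(G_{\mathbb C}^{\theta})_0\subset K_{\mathbb C}\subset G_{\mathbb C}^{\theta}$, where $G_{\mathbb C}^{\theta}$ is the fixed point group of $\theta$ and $(G_{\mathbb C}^{\theta})_0$ its identity component (for example $K_{\mathbb C}=(G_{\mathbb C}^{\theta})_0$). Let $\mathfrak g_{\mathbb R}$ be a real form of $\mathfrak g_{\mathbb C}$ that is stable under the differential $d\theta$ and on which $d\theta$ is a Cartan involution, i.e. $(X,Y)\mapsto -B(X,d\theta\, Y)$ is positive definite on $\mathfrak g_{\mathbb R}$ for the Killing form $B$ of $\mathfrak g_{\mathbb R}$. Let $\mathcal N_{\mathbb C}$ be the set of nilpotent elements of $\mathfrak g_{\mathbb C}$ and let $\mathcal N_{\mathbb R,\mathbb C}=\{X\in\mathcal N_{\mathbb C}:\operatorname{Ad}(G_{\mathbb C})X\cap\mathfrak g_{\mathbb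 R}\neq\emptyset\}$. Let $\mathbb O^{\mathbb C}_{\min,\mathbb R}$ be a $G_{\mathbb C}$-orbit that is minimal in $(\mathcal N_{\mathbb R,\mathbb C}\setminus\{0\})/G_{\mathbb C}$ with respect to the closure relation ($\mathbb O'\le\mathbb O$ iff $\mathbb O'\subset\overline{\mathbb O}$), regarded as a coadjoint orbit in $\mathfrak g_{\mathbb C}^*$ through the isomorphism $\mathfrak g_{\mathbb C}\simeq\mathfrak g_{\mathbb C}^*$ given by the Killing form of $\mathfrak g_{\mathbb C}$. Then the coadjoint action of $K_{\mathbb C}$ on $\mathbb O^{\mathbb C}_{\min,\mathbb R}$ is coisotropic: there is a $K_{\mathbb C}$-stable open dense subset $U$ of $\mathbb O^{\mathbb C}_{\min,\mathbb R}$ such that, for every $\lambda\in U$, the subspace $W=T_\lambda(\operatorname{Ad}^*(K_{\mathbb C})\lambda)$ of $T_\lambda\mathbb O^{\mathbb C}_{\min,\mathbb R}$ satisfies $W^{\perp}\subset W$, where $\perp$ is taken with respect to the Kirillov--Kostant--Souriau symplectic form, i.e. the form $(X,Y)\mapsto\lambda([X,Y])$ on $T_\lambda\mathbb O^{\mathbb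 C}_{\min,\mathbb R}\simeq\mathfrak g_{\mathbb C}/Z_{\mathfrak g_{\mathbb C}}(\lambda)$ with $Z_{\mathfrak g_{\mathbb C}}(\lambda)=\{X:\lambda([X,Y])=0\text{ for all }Y\in\mathfrak g_{\mathbb C}\}$. -/

import Mathlib

open scoped Manifold ContDiff

noncomputable section

/-! ### Linear and Lie algebra -/

/-- A subspace `W` of a space with a bilinear (symplectic) form `σ` is coisotropic if
`W^⊥ ⊆ W`, where `W^⊥` consists of the `v` such that `σ(v, ·)` vanishes on `W`. -/
def IsCoisotropicSubspace {V : Type*} [AddCommGroup V] [Module ℂ V]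
    (σ : V →ₗ[ℂ] V →ₗ[ℂ] ℂ) (W : Submodule ℂ V) : Prop :=
  ∀ v : V, (∀ w ∈ W, σ v w = 0) → v ∈ W

section LieAlgebraPart

variable {L : Type*} [LieRing L] [LieAlgebra ℂ L]

/-- The bilinear form `(X, Y) ↦ ν([X, Y])` on a Lie algebra attached to a linear form `ν`. -/
def kirillovForm (ν : Module.Dual ℂ L) : L →ₗ[ℂ] L →ₗ[ℂ] ℂ :=
  LinearMap.mk₂ ℂ (fun X Y => ν ⁅X, Y⁆) (by simp) (by simp) (by simp) (by simp)

/-- The Lie algebra `Z(ν)` of the stabilizer of `ν` for the coadjoint action: the `X` such that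
`ν([X, Y]) = 0` for all `Y`. -/
def coadjointStabilizer (ν : Module.Dual ℂ L) : Submodule ℂ L :=
  LinearMap.ker (kirillovForm ν)

theorem coadjointStabilizer_le_ker_flip (ν : Module.Dual ℂ L) :
    coadjointStabilizer ν ≤ LinearMap.ker (kirillovForm ν).flip := by
  intro Y hY
  have h : kirillovForm ν Y = 0 := hY
  refine LinearMap.mem_ker.mpr (LinearMap.ext fun X => ?_)
  have h2 : ν ⁅Y, X⁆ = 0 := LinearMap.congr_fun h X
  change ν ⁅X, Y⁆ = 0
  rw [← lie_skew, map_neg, h2, neg_zero]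

/-- The (holomorphic) Kirillov--Kostant--Souriau symplectic form at the point `ν` of its coadjoint
orbit. The tangent space at `ν` is `L / Z(ν)`, and the form is `(X, Y) ↦ ν([X, Y])`. -/
def kksForm (ν : Module.Dual ℂ L) :
    (L ⧸ coadjointStabilizer ν) →ₗ[ℂ] (L ⧸ coadjointStabilizer ν) →ₗ[ℂ] ℂ :=
  (kirillovForm ν).liftQ₂ (coadjointStabilizer ν) (coadjointStabilizer ν) le_rfl
    (coadjointStabilizer_le_ker_flip ν)

/-- A complex Lie algebra, regarded as a real Lie algebra. -/
instance lieAlgebraComplexToReal : LieAlgebra ℝ L where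
  toModule := Module.complexToReal L
  lie_smul t X Y := by
    have h : ⁅X, (t : ℂ) • Y⁆ = (t : ℂ) • ⁅X, Y⁆ := lie_smul (t : ℂ) X Y
    simpa using h

/-- A real Lie subalgebra `S` of a complex Lie algebra `L` is a real form if `L = S ⊕ i S`. -/
def IsRealForm (S : LieSubalgebra ℝ L) : Prop :=
  ∀ Z : L, ∃! p : S × S, Z = (p.1 : L) + Complex.I • (p.2 : L)

/-- The involutive automorphism `τ` of `L` restricts to a Cartan involution of the real form `S`:
it preserves `S`, and `(X, Y) ↦ -B(X, τ Y)` is positive definite on `S`, where `B` is the Killing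
form of the real Lie algebra `S`. -/
def RestrictsToCartanInvolution (τ : L → L) (S : LieSubalgebra ℝ L) : Prop :=
  ∃ h : ∀ X ∈ S, τ X ∈ S,
    ∀ X : S, X ≠ 0 → killingForm ℝ S X ⟨τ X, h X X.2⟩ < 0

/-- The nilpotent cone of a (semisimple) Lie algebra. -/
def nilpotentCone (L : Type*) [LieRing L] [LieAlgebra ℂ L] : Set L :=
  {X | IsNilpotent (LieAlgebra.ad ℂ L X)}

end LieAlgebraPart

/-! ### Complex Lie groups, adjoint and coadjoint orbits -/

section GroupPart

variable {E : Type*} [NormedAddCommGroup E] [NormedSpace ℂ E]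
  {G : Type*} [TopologicalSpace G] [ChartedSpace E G] [Group G]

/-- The adjoint action of `g`: the differential at `1` of the conjugation `x ↦ g x g⁻¹`. -/
def adjointAction (g : G) :
    GroupLieAlgebra 𝓘(ℂ, E) G →L[ℂ] GroupLieAlgebra 𝓘(ℂ, E) G :=
  mfderiv 𝓘(ℂ, E) 𝓘(ℂ, E) (fun x : G => g * x * g⁻¹) 1

/-- The coadjoint action of `g`: it sends `ν` to `ν ∘ Ad(g⁻¹)`. -/
def coadjointAction (g : G) (ν : GroupLieAlgebra 𝓘(ℂ, E) G →L[ℂ] ℂ) :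
    GroupLieAlgebra 𝓘(ℂ, E) G →L[ℂ] ℂ :=
  ν.comp (adjointAction g⁻¹)

/-- The differential at `1` of an endomorphism of `G`. -/
def lieDifferential (θ : G →* G) :
    GroupLieAlgebra 𝓘(ℂ, E) G →L[ℂ] GroupLieAlgebra 𝓘(ℂ, E) G :=
  mfderiv 𝓘(ℂ, E) 𝓘(ℂ, E) θ 1

/-- The Lie algebra of a complex Lie subgroup `H` of `G`: the space of velocities at `1` of
curves in `H` that are holomorphic near `0`. -/
def subgroupLieAlgebra (H : Subgroup G) : Submodule ℂ (GroupLieAlgebra 𝓘(ℂ, E) G) :=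
  Submodule.span ℂ {X | ∃ c : ℂ → G, (∀ z, c z ∈ H) ∧ c 0 = 1 ∧
    ContMDiffAt 𝓘(ℂ, ℂ) 𝓘(ℂ, E) ω c 0 ∧
    X = (show E from mfderiv 𝓘(ℂ, ℂ) 𝓘(ℂ, E) c 0 (show ℂ from 1))}

/-- The adjoint orbit through `X`. -/
def adjointOrbit (X : GroupLieAlgebra 𝓘(ℂ, E) G) : Set (GroupLieAlgebra 𝓘(ℂ, E) G) :=
  Set.range fun g : G => adjointAction g X

variable [CompleteSpace E] [LieGroup 𝓘(ℂ, E) ω G]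

/-- The set of the nilpotent elements whose adjoint orbit under `G` meets the real form `S`. -/
def nilpotentMeeting (S : LieSubalgebra ℝ (GroupLieAlgebra 𝓘(ℂ, E) G)) :
    Set (GroupLieAlgebra 𝓘(ℂ, E) G) :=
  {X | X ∈ nilpotentCone (GroupLieAlgebra 𝓘(ℂ, E) G) ∧
    (adjointOrbit X ∩ (S : Set (GroupLieAlgebra 𝓘(ℂ, E) G))).Nonempty}

/-- `O` is a minimal element, for the closure relation, of the set of nonzero nilpotent orbits of
`G` that meet the real form `S`. -/
def IsMinimalOrbitMeeting (S : LieSubalgebra ℝ (GroupLieAlgebra 𝓘(ℂ, E) G))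
    (O : Set (GroupLieAlgebra 𝓘(ℂ, E) G)) : Prop :=
  (∃ X ∈ nilpotentMeeting S, X ≠ 0 ∧ O = adjointOrbit X) ∧
    ∀ Y ∈ nilpotentMeeting S, Y ≠ 0 → adjointOrbit Y ⊆ closure O → adjointOrbit Y = O

/-- The set of linear forms corresponding to a set of vectors under the isomorphism of the Lie
algebra with its dual given by the Killing form. -/
def killingDual (O : Set (GroupLieAlgebra 𝓘(ℂ, E) G)) :
    Set (GroupLieAlgebra 𝓘(ℂ, E) G →L[ℂ] ℂ) :=
  {ν | ∃ X ∈ O, ∀ Y, ν Y = killingForm ℂ (GroupLieAlgebra 𝓘(ℂ, E) G) X Y}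

/-- The coadjoint action of the complex Lie subgroup `H` of `G` on the coadjoint orbit `O` of `G`
is coisotropic: there is an `H`-stable open dense subset `U` of `O` such that, for all `ν` in `U`,
the tangent space at `ν` of the `H`-orbit of `ν` is a coisotropic subspace of the tangent space
of `O`. The tangent space of `O` at `ν` is the Lie algebra of `G` modulo `Z(ν)`, and the tangent
space of the `H`-orbit is the image of the Lie algebra of `H`. -/
def IsCoisotropicCoadjointAction (H : Subgroup G)
    (O : Set (GroupLieAlgebra 𝓘(ℂ, E) G →L[ℂ] ℂ)) : Prop :=
  ∃ U : Set (GroupLieAlgebra 𝓘(ℂ, E) G →L[ℂ] ℂ),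
    (∀ h ∈ H, ∀ ν ∈ U, coadjointAction h ν ∈ U) ∧
    (∃ V : Set (GroupLieAlgebra 𝓘(ℂ, E) G →L[ℂ] ℂ), IsOpen V ∧ U = O ∩ V) ∧
    O ⊆ closure U ∧
    ∀ ν ∈ U, IsCoisotropicSubspace (kksForm ν.toLinearMap)
      ((subgroupLieAlgebra H).map (coadjointStabilizer ν.toLinearMap).mkQ)

end GroupPart

end

open scoped Manifold ContDiff

noncomputable section

set_option linter.unusedSectionVars false

open Filter Topology Set VectorField

/-! ### Differentials of homomorphisms and the adjoint action. -/

section LieGroupBasics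

variable {E : Type*} [NormedAddCommGroup E] [NormedSpace ℂ E]
  {G : Type*} [TopologicalSpace G] [ChartedSpace E G] [Group G]

/-! A subspace of codimension at most one in a symplectic space is coisotropic, so it suffices that
the generic `K`-orbit in the minimal orbit `O` has codimension at most one. This condition is the
nonvanishing of a minor of the Kirillov form with rows in Lie(`K`). It is open and `K`-stable, and
because the minor pulls back to a holomorphic function on the connected group `G`, it holds on a
dense subset of `O` as soon as it holds at one point (`dense_ne_zero_of_contMDiff`,
`isCoisotropicCoadjointAction_of_lie_le`).

The one point is a "highest weight vector" of the real form. Choose a maximal abelian subspace 𝔞 of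
the (-1)-eigenspace of the Cartan involution and a generic `H` in 𝔞. Among the points of
closure(`O`) ∩ `gR`, let `l` be the largest eigenvalue of `ad H` that occurs in one of them, and let
`Y` be the `l`-component of such a point. Since closure(`O`) is a closed cone stable under exp(ad),
`Y` is a limit of exp(-tl) exp(t ad `H`) applied to that point, so `Y` is again in the closure. If
`N` is an eigenvector of positive eigenvalue, then [`N`, `Y`] is tangent to a curve in closure(`O`)
∩ `gR` but has eigenvalue above `l`, hence it is zero. The Iwasawa decomposition 𝔨 + 𝔞 + 𝔫 of `gR`
then gives [`gR`, `Y`] ⊆ [𝔨, `Y`] + ℝ`Y`, because 𝔫 kills `Y` and 𝔞 scales it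
(`exists_regular_hyperbolic_element`, `exists_mem_realForm_lie_le_fixed_sup_span`). Complexifying
gives the codimension bound at `Y`, and minimality of `O` forces `Y` to lie in `O` itself.

Two facts of Lie theory link this to the group. Closed Ad(`G`)-stable sets are stable under exp(ad
`Z`), which is proved without an exponential map of `G`, from the derivative of Ad and the limit of
n-th powers (`fderiv_fderiv_conjChart`, `tendsto_pow_exp`, `exp_ad_mem_of_isClosed`). Fixed vectors
of the differential of `θ` lie in Lie(`K`), by linearizing `θ` near the identity
(`mem_subgroupLieAlgebra_of_lieDifferential_eq`). -/

theorem lieDifferential_comp_apply {f h : G →* G} (hf : ContMDiff 𝓘(ℂ, E) 𝓘(ℂ, E) ω f)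
    (hh : ContMDiff 𝓘(ℂ, E) 𝓘(ℂ, E) ω h) (v : GroupLieAlgebra 𝓘(ℂ, E) G) :
    lieDifferential (E := E) (f.comp h) v = lieDifferential f (lieDifferential h v) := by
  have h1 : h 1 = 1 := map_one h
  have key : mfderiv 𝓘(ℂ, E) 𝓘(ℂ, E) (f ∘ h) 1 =
      (mfderiv 𝓘(ℂ, E) 𝓘(ℂ, E) f (h 1)).comp (mfderiv 𝓘(ℂ, E) 𝓘(ℂ, E) h 1) :=
    mfderiv_comp 1 (hf.mdifferentiable (by simp) _) (hh.mdifferentiable (by simp) _)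
  have h2 : (mfderiv 𝓘(ℂ, E) 𝓘(ℂ, E) f (h 1) : E →L[ℂ] E) =
      mfderiv 𝓘(ℂ, E) 𝓘(ℂ, E) f 1 := by rw [h1]
  exact (DFunLike.congr_fun key v).trans
    (DFunLike.congr_fun h2 (mfderiv 𝓘(ℂ, E) 𝓘(ℂ, E) h 1 v))

theorem lieDifferential_id_apply (v : GroupLieAlgebra 𝓘(ℂ, E) G) :
    lieDifferential (E := E) (MonoidHom.id G) v = v := by
  have : mfderiv 𝓘(ℂ, E) 𝓘(ℂ, E) (id : G → G) 1 = ContinuousLinearMap.id ℂ _ := mfderiv_id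
  exact DFunLike.congr_fun this v

variable [CompleteSpace E] [LieGroup 𝓘(ℂ, E) ω G]

/-- Differentiating f(gx) = f(g)f(x) at x = 1 shows that `f` intertwines the two left-invariant
fields. The inverse `k` is present because the pullback is defined through the inverse of the
derivative. -/
theorem mpullback_mulInvariantVectorField_lieDifferential {f k : G →* G}
    (hf : ContMDiff 𝓘(ℂ, E) 𝓘(ℂ, E) ω f) (hk : ContMDiff 𝓘(ℂ, E) 𝓘(ℂ, E) ω k)
    (hfk : ∀ x, f (k x) = x) (hkf : ∀ x, k (f x) = x) (v : GroupLieAlgebra 𝓘(ℂ, E) G) :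
    mpullback 𝓘(ℂ, E) 𝓘(ℂ, E) f (mulInvariantVectorField (lieDifferential f v)) =
      mulInvariantVectorField v := by
  ext g
  have A : mfderiv 𝓘(ℂ, E) 𝓘(ℂ, E) (k ∘ f) g =
      (mfderiv 𝓘(ℂ, E) 𝓘(ℂ, E) k (f g)).comp (mfderiv 𝓘(ℂ, E) 𝓘(ℂ, E) f g) :=
    mfderiv_comp g (hk.mdifferentiable (by simp) _) (hf.mdifferentiable (by simp) _)
  have A' : (k ∘ f : G → G) = id := funext hkf
  have B : mfderiv 𝓘(ℂ, E) 𝓘(ℂ, E) (f ∘ k) (f g) =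
      (mfderiv 𝓘(ℂ, E) 𝓘(ℂ, E) f (k (f g))).comp (mfderiv 𝓘(ℂ, E) 𝓘(ℂ, E) k (f g)) :=
    mfderiv_comp (f g) (hf.mdifferentiable (by simp) _) (hk.mdifferentiable (by simp) _)
  have B' : (f ∘ k : G → G) = id := funext hfk
  rw [A', mfderiv_id] at A
  rw [B', mfderiv_id, hkf] at B
  have hinv : (mfderiv 𝓘(ℂ, E) 𝓘(ℂ, E) f g).inverse = mfderiv 𝓘(ℂ, E) 𝓘(ℂ, E) k (f g) :=
    ContinuousLinearMap.inverse_eq B.symm A.symm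
  have hL (g : G) : MDifferentiable 𝓘(ℂ, E) 𝓘(ℂ, E) (fun x : G => g * x) :=
    (contMDiff_mul_left (n := ω)).mdifferentiable (by simp)
  have h1 : f 1 = 1 := map_one f
  have C : mfderiv 𝓘(ℂ, E) 𝓘(ℂ, E) ((fun x => f g * x) ∘ f) 1 =
      (mfderiv 𝓘(ℂ, E) 𝓘(ℂ, E) (fun x => f g * x) (f 1)).comp
        (mfderiv 𝓘(ℂ, E) 𝓘(ℂ, E) f 1) :=
    mfderiv_comp 1 (hL _ _) (hf.mdifferentiable (by simp) _)
  have C' : ((fun x => f g * x) ∘ f : G → G) = f ∘ (fun x => g * x) := by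
    ext x; simp
  have D : mfderiv 𝓘(ℂ, E) 𝓘(ℂ, E) (f ∘ (fun x => g * x)) 1 =
      (mfderiv 𝓘(ℂ, E) 𝓘(ℂ, E) f (g * 1)).comp
        (mfderiv 𝓘(ℂ, E) 𝓘(ℂ, E) (fun x => g * x) 1) :=
    mfderiv_comp 1 (hf.mdifferentiable (by simp) _) (hL _ _)
  rw [C', D] at C
  have h3 : (mfderiv 𝓘(ℂ, E) 𝓘(ℂ, E) (fun x => f g * x) (f 1) : E →L[ℂ] E) =
      mfderiv 𝓘(ℂ, E) 𝓘(ℂ, E) (fun x => f g * x) 1 := by rw [h1]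
  have h4 : (mfderiv 𝓘(ℂ, E) 𝓘(ℂ, E) f (g * 1) : E →L[ℂ] E) =
      mfderiv 𝓘(ℂ, E) 𝓘(ℂ, E) f g := by rw [mul_one]
  have e1 : mulInvariantVectorField (lieDifferential f v) (f g) =
      mfderiv 𝓘(ℂ, E) 𝓘(ℂ, E) f g (mulInvariantVectorField v g) := by
    refine (DFunLike.congr_fun h3 (mfderiv 𝓘(ℂ, E) 𝓘(ℂ, E) f 1 v)).symm.trans ?_
    refine (DFunLike.congr_fun C v).symm.trans ?_
    exact DFunLike.congr_fun h4 (mfderiv 𝓘(ℂ, E) 𝓘(ℂ, E) (fun x => g * x) 1 v)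
  rw [mpullback_apply, hinv, e1]
  exact (DFunLike.congr_fun A (mulInvariantVectorField v g)).symm

/-- The differential of an invertible endomorphism of a Lie group preserves brackets. -/
theorem lieDifferential_lie {f k : G →* G}
    (hf : ContMDiff 𝓘(ℂ, E) 𝓘(ℂ, E) ω f) (hk : ContMDiff 𝓘(ℂ, E) 𝓘(ℂ, E) ω k)
    (hfk : ∀ x, f (k x) = x) (hkf : ∀ x, k (f x) = x) (v w : GroupLieAlgebra 𝓘(ℂ, E) G) :
    lieDifferential f ⁅v, w⁆ = ⁅lieDifferential (E := E) f v, lieDifferential (E := E) f w⁆ := by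
  have key := mpullback_mlieBracket (I := 𝓘(ℂ, E)) (I' := 𝓘(ℂ, E)) (f := f) (x₀ := 1) (n := ω)
    (V := mulInvariantVectorField (lieDifferential f v))
    (W := mulInvariantVectorField (lieDifferential f w))
    (mdifferentiableAt_mulInvariantVectorField _) (mdifferentiableAt_mulInvariantVectorField _)
    (hf 1) (by simp)
  rw [mpullback_mulInvariantVectorField_lieDifferential hf hk hfk hkf,
    mpullback_mulInvariantVectorField_lieDifferential hf hk hfk hkf, mpullback_apply] at key
  have h1 : f 1 = 1 := map_one f
  have h2 : (mlieBracket 𝓘(ℂ, E) (mulInvariantVectorField (lieDifferential f v))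
      (mulInvariantVectorField (lieDifferential f w)) (f 1) : E) =
      ⁅lieDifferential (E := E) f v, lieDifferential (E := E) f w⁆ := by
    rw [h1]; rfl
  have c1 : ∀ u, lieDifferential (E := E) f (lieDifferential k u) = u := fun u => by
    rw [← lieDifferential_comp_apply hf hk, show f.comp k = MonoidHom.id G from
      MonoidHom.ext hfk, lieDifferential_id_apply]
  have c2 : ∀ u, lieDifferential (E := E) k (lieDifferential f u) = u := fun u => by
    rw [← lieDifferential_comp_apply hk hf, show k.comp f = MonoidHom.id G from
      MonoidHom.ext hkf, lieDifferential_id_apply]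
  have hinv : ((mfderiv 𝓘(ℂ, E) 𝓘(ℂ, E) f 1 : E →L[ℂ] E)).inverse =
      (lieDifferential k : E →L[ℂ] E) :=
    ContinuousLinearMap.inverse_eq (ContinuousLinearMap.ext c1) (ContinuousLinearMap.ext c2)
  have h5 : lieDifferential (E := E) k (mlieBracket 𝓘(ℂ, E)
      (mulInvariantVectorField (lieDifferential f v))
      (mulInvariantVectorField (lieDifferential f w)) (f 1) : E) = ⁅v, w⁆ :=
    (DFunLike.congr_fun hinv _).symm.trans key
  rw [← h5]
  exact (c1 _).trans h2

theorem contMDiff_conj (g : G) :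
    ContMDiff 𝓘(ℂ, E) 𝓘(ℂ, E) ω (MulAut.conj g).toMonoidHom := by
  have : ContMDiff 𝓘(ℂ, E) 𝓘(ℂ, E) ω (fun x : G => g * x * g⁻¹) :=
    (contMDiff_const.mul contMDiff_id).mul contMDiff_const
  exact this

theorem adjointAction_mul_apply (g h : G) (v : GroupLieAlgebra 𝓘(ℂ, E) G) :
    adjointAction (E := E) (g * h) v = adjointAction g (adjointAction h v) := by
  have := lieDifferential_comp_apply (E := E) (contMDiff_conj g) (contMDiff_conj h) v
  rw [show (MulAut.conj g).toMonoidHom.comp (MulAut.conj h).toMonoidHom =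
    (MulAut.conj (g * h)).toMonoidHom by rw [map_mul]; rfl] at this
  exact this

theorem adjointAction_one_apply (v : GroupLieAlgebra 𝓘(ℂ, E) G) :
    adjointAction (E := E) (1 : G) v = v := by
  have := lieDifferential_id_apply (E := E) (G := G) v
  rw [show MonoidHom.id G = (MulAut.conj (1 : G)).toMonoidHom by rw [map_one]; rfl] at this
  exact this

theorem adjointAction_inv_apply_apply (g : G) (v : GroupLieAlgebra 𝓘(ℂ, E) G) :
    adjointAction (E := E) g⁻¹ (adjointAction g v) = v := by
  rw [← adjointAction_mul_apply, inv_mul_cancel, adjointAction_one_apply]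

theorem adjointAction_apply_inv_apply (g : G) (v : GroupLieAlgebra 𝓘(ℂ, E) G) :
    adjointAction (E := E) g (adjointAction g⁻¹ v) = v := by
  rw [← adjointAction_mul_apply, mul_inv_cancel, adjointAction_one_apply]

theorem adjointAction_lie (g : G) (v w : GroupLieAlgebra 𝓘(ℂ, E) G) :
    adjointAction g ⁅v, w⁆ = ⁅adjointAction (E := E) g v, adjointAction (E := E) g w⁆ :=
  lieDifferential_lie (contMDiff_conj g) (contMDiff_conj g⁻¹)
    (fun x => by simp [mul_assoc]) (fun x => by simp [mul_assoc]) v w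

/-- The adjoint action, as an automorphism of the Lie algebra. -/
def adjointLieEquiv (g : G) :
    GroupLieAlgebra 𝓘(ℂ, E) G ≃ₗ⁅ℂ⁆ GroupLieAlgebra 𝓘(ℂ, E) G where
  toFun := adjointAction g
  invFun := adjointAction g⁻¹
  map_add' := map_add _
  map_smul' := map_smul _
  map_lie' := adjointAction_lie g _ _
  left_inv := adjointAction_inv_apply_apply g
  right_inv := adjointAction_apply_inv_apply g

theorem killingForm_adjointAction (g : G) (v w : GroupLieAlgebra 𝓘(ℂ, E) G) :
    killingForm ℂ (GroupLieAlgebra 𝓘(ℂ, E) G) (adjointAction (E := E) g v)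
      (adjointAction (E := E) g w) =
    killingForm ℂ (GroupLieAlgebra 𝓘(ℂ, E) G) v w :=
  LieAlgebra.killingForm_of_equiv_apply (adjointLieEquiv (E := E) g) v w

end LieGroupBasics

/-! ### The group law in a chart at the identity, and the derivative of Ad. -/

section ChartAtOne

variable {E : Type*} [NormedAddCommGroup E] [NormedSpace ℂ E]
  {G : Type*} [TopologicalSpace G] [ChartedSpace E G] [Group G]

variable (E G) in
/-- The preferred chart at the identity. -/
abbrev chartOne : PartialEquiv G E := extChartAt 𝓘(ℂ, E) (1 : G)

variable (E G) in
/-- The multiplication read in the chart at the identity. -/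
def mulChart (p : E × E) : E :=
  chartOne E G ((chartOne E G).symm p.1 * (chartOne E G).symm p.2)

variable (E G) in
/-- The conjugation `(g, x) ↦ g x g⁻¹` read in the chart at the identity. -/
def conjChart (p : E × E) : E :=
  chartOne E G ((chartOne E G).symm p.1 * (chartOne E G).symm p.2 * ((chartOne E G).symm p.1)⁻¹)

theorem chartOne_symm_self : (chartOne E G).symm (chartOne E G 1) = 1 :=
  extChartAt_to_inv (I := 𝓘(ℂ, E)) (1 : G)

variable [CompleteSpace E] [LieGroup 𝓘(ℂ, E) ω G]

theorem contMDiffAt_chartOne_symm :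
    ContMDiffAt 𝓘(ℂ, E) 𝓘(ℂ, E) ω (chartOne E G).symm (chartOne E G 1) :=
  (contMDiffOn_extChartAt_symm (1 : G)).contMDiffAt (extChartAt_target_mem_nhds (1 : G))

theorem contMDiffAt_chartOne : ContMDiffAt 𝓘(ℂ, E) 𝓘(ℂ, E) ω (chartOne E G) 1 :=
  contMDiffAt_extChartAt

theorem contMDiffAt_chartOne_symm_fst :
    ContMDiffAt 𝓘(ℂ, E × E) 𝓘(ℂ, E) ω (fun p : E × E => (chartOne E G).symm p.1)
      (chartOne E G 1, chartOne E G 1) :=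
  ContMDiffAt.comp (I' := 𝓘(ℂ, E)) (f := Prod.fst) (g := (chartOne E G).symm) _
    contMDiffAt_chartOne_symm contDiff_fst.contMDiff.contMDiffAt

theorem contMDiffAt_chartOne_symm_snd :
    ContMDiffAt 𝓘(ℂ, E × E) 𝓘(ℂ, E) ω (fun p : E × E => (chartOne E G).symm p.2)
      (chartOne E G 1, chartOne E G 1) :=
  ContMDiffAt.comp (I' := 𝓘(ℂ, E)) (f := Prod.snd) (g := (chartOne E G).symm) _
    contMDiffAt_chartOne_symm contDiff_snd.contMDiff.contMDiffAt

theorem contDiffAt_mulChart : ContDiffAt ℂ ω (mulChart E G) (chartOne E G 1, chartOne E G 1) := by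
  rw [← contMDiffAt_iff_contDiffAt]
  refine ContMDiffAt.comp_of_eq (I' := 𝓘(ℂ, E)) (g := chartOne E G)
    (y := 1) contMDiffAt_chartOne
    (contMDiffAt_chartOne_symm_fst.mul contMDiffAt_chartOne_symm_snd) ?_
  simp

theorem contDiffAt_conjChart :
    ContDiffAt ℂ ω (conjChart E G) (chartOne E G 1, chartOne E G 1) := by
  rw [← contMDiffAt_iff_contDiffAt]
  refine ContMDiffAt.comp_of_eq (I' := 𝓘(ℂ, E)) (g := chartOne E G)
    (y := 1) contMDiffAt_chartOne
    ((contMDiffAt_chartOne_symm_fst.mul contMDiffAt_chartOne_symm_snd).mul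
      contMDiffAt_chartOne_symm_fst.inv) ?_
  simp

theorem tendsto_chartOne_symm :
    Tendsto (chartOne E G).symm (𝓝 (chartOne E G 1)) (𝓝 1) := by
  have := (contMDiffAt_chartOne_symm (E := E) (G := G)).continuousAt.tendsto
  rwa [chartOne_symm_self] at this

theorem mfderiv_chartOne_symm :
    (mfderiv 𝓘(ℂ, E) 𝓘(ℂ, E) (chartOne E G).symm (chartOne E G 1) : E →L[ℂ] E) =
      ContinuousLinearMap.id ℂ E := by
  have := mfderivWithin_range_extChartAt_symm (I := 𝓘(ℂ, E)) (x := (1 : G))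
  rw [modelWithCornersSelf_coe, range_id, mfderivWithin_univ] at this
  exact this

theorem mfderiv_chartOne :
    (mfderiv 𝓘(ℂ, E) 𝓘(ℂ, E) (chartOne E G) 1 : E →L[ℂ] E) = ContinuousLinearMap.id ℂ E :=
  mfderiv_extChartAt_self (I := 𝓘(ℂ, E)) (x := (1 : G))

/-- The derivative, at the chart image of `1`, of a self-map of `G` read in the chart. -/
theorem fderiv_chartOne_comp {f : G → G} (hf : MDifferentiableAt 𝓘(ℂ, E) 𝓘(ℂ, E) f 1)
    (h1 : f 1 ∈ (chartOne E G).source) (v : E) :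
    fderiv ℂ (fun y => chartOne E G (f ((chartOne E G).symm y))) (chartOne E G 1) v =
      mfderiv 𝓘(ℂ, E) 𝓘(ℂ, E) (chartOne E G) (f 1)
        (mfderiv 𝓘(ℂ, E) 𝓘(ℂ, E) f 1 v) := by
  have hφ : MDifferentiableAt 𝓘(ℂ, E) 𝓘(ℂ, E) (chartOne E G) (f 1) :=
    (contMDiffAt_extChartAt' (n := ω) (by simpa using h1)).mdifferentiableAt (by simp)
  have hs : MDifferentiableAt 𝓘(ℂ, E) 𝓘(ℂ, E) (chartOne E G).symm (chartOne E G 1) :=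
    contMDiffAt_chartOne_symm.mdifferentiableAt (by simp)
  have h0 : (chartOne E G).symm (chartOne E G 1) = 1 := chartOne_symm_self
  rw [← mfderiv_eq_fderiv]
  have a := mfderiv_comp (chartOne E G 1) (g := fun x => chartOne E G (f x))
    (f := (chartOne E G).symm) (I' := 𝓘(ℂ, E)) (I := 𝓘(ℂ, E)) (I'' := 𝓘(ℂ, E))
    (by rw [h0]; exact hφ.comp 1 hf) hs
  have b := mfderiv_comp 1 (g := chartOne E G) (f := f) (I' := 𝓘(ℂ, E)) (I := 𝓘(ℂ, E))
    (I'' := 𝓘(ℂ, E)) hφ hf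
  have c : (mfderiv 𝓘(ℂ, E) 𝓘(ℂ, E) (fun x => chartOne E G (f x))
      ((chartOne E G).symm (chartOne E G 1)) : E →L[ℂ] E) =
      mfderiv 𝓘(ℂ, E) 𝓘(ℂ, E) (fun x => chartOne E G (f x)) 1 := by rw [h0]
  refine (DFunLike.congr_fun a v).trans ?_
  refine (DFunLike.congr_fun c _).trans ?_
  refine (DFunLike.congr_fun b _).trans ?_
  change mfderiv 𝓘(ℂ, E) 𝓘(ℂ, E) (chartOne E G) (f 1) (mfderiv 𝓘(ℂ, E) 𝓘(ℂ, E) f 1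
    ((mfderiv 𝓘(ℂ, E) 𝓘(ℂ, E) (chartOne E G).symm (chartOne E G 1) : E →L[ℂ] E) v)) = _
  rw [mfderiv_chartOne_symm]
  rfl

theorem fderiv_chartOne_comp_of_map_one {f : G → G}
    (hf : MDifferentiableAt 𝓘(ℂ, E) 𝓘(ℂ, E) f 1) (h1 : f 1 = 1) (v : E) :
    fderiv ℂ (fun y => chartOne E G (f ((chartOne E G).symm y))) (chartOne E G 1) v =
      (show E from mfderiv 𝓘(ℂ, E) 𝓘(ℂ, E) f 1 v) := by
  rw [fderiv_chartOne_comp hf (by rw [h1]; exact mem_extChartAt_source (1 : G))]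
  have c : (mfderiv 𝓘(ℂ, E) 𝓘(ℂ, E) (chartOne E G) (f 1) : E →L[ℂ] E) =
      ContinuousLinearMap.id ℂ E := by rw [h1]; exact mfderiv_chartOne
  exact DFunLike.congr_fun c _

theorem fderiv_partial_snd {F : E × E → E} {x y : E} (hF : DifferentiableAt ℂ F (x, y)) (v : E) :
    fderiv ℂ (fun z => F (x, z)) y v = fderiv ℂ F (x, y) (0, v) := by
  have h := hF.hasFDerivAt.comp y (hasFDerivAt_prodMk_right x y)
  exact DFunLike.congr_fun h.fderiv v

theorem fderiv_partial_fst {F : E × E → E} {x y : E} (hF : DifferentiableAt ℂ F (x, y)) (v : E) :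
    fderiv ℂ (fun z => F (z, y)) x v = fderiv ℂ F (x, y) (v, 0) := by
  have h := HasFDerivAt.comp (f := fun z => (z, y)) x hF.hasFDerivAt (hasFDerivAt_prodMk_left x y)
  exact DFunLike.congr_fun h.fderiv v

theorem eventually_differentiableAt_of_contDiffAt {F : E × E → E} {p : E × E}
    (hF : ContDiffAt ℂ ω F p) : ∀ᶠ q in 𝓝 p, DifferentiableAt ℂ F q := by
  filter_upwards [hF.eventually (by simp)] with q hq
  exact hq.differentiableAt (by simp)

theorem eventually_adjointAction_eq :
    ∀ᶠ x in 𝓝 (chartOne E G 1), ∀ v : E,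
      (adjointAction ((chartOne E G).symm x) v : E) =
        fderiv ℂ (conjChart E G) (x, chartOne E G 1) (0, v) := by
  have h := eventually_differentiableAt_of_contDiffAt (contDiffAt_conjChart (E := E) (G := G))
  have h2 : Tendsto (fun x : E => (x, chartOne E G 1)) (𝓝 (chartOne E G 1))
      (𝓝 (chartOne E G 1, chartOne E G 1)) :=
    (Continuous.prodMk_left (chartOne E G 1)).tendsto _
  filter_upwards [h2.eventually h] with x hx v
  rw [← fderiv_partial_snd hx]
  have := fderiv_chartOne_comp_of_map_one (E := E)
    (f := fun y : G => (chartOne E G).symm x * y * ((chartOne E G).symm x)⁻¹)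
    ((contMDiff_conj (E := E) ((chartOne E G).symm x)).mdifferentiable (by simp) 1)
    (by simp) v
  exact this.symm

theorem eventually_mpullbackWithin_mulInvariantVectorField_eq :
    ∀ᶠ x in 𝓝 (chartOne E G 1), ∀ v : E,
      (mpullbackWithin 𝓘(ℂ, E) 𝓘(ℂ, E) (chartOne E G).symm
        (mulInvariantVectorField (I := 𝓘(ℂ, E)) (G := G) v)
        (range 𝓘(ℂ, E)) x : E) =
        fderiv ℂ (mulChart E G) (x, chartOne E G 1) (0, v) := by
  have h := eventually_differentiableAt_of_contDiffAt (contDiffAt_mulChart (E := E) (G := G))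
  have h2 : Tendsto (fun x : E => (x, chartOne E G 1)) (𝓝 (chartOne E G 1))
      (𝓝 (chartOne E G 1, chartOne E G 1)) :=
    (Continuous.prodMk_left (chartOne E G 1)).tendsto _
  filter_upwards [h2.eventually h, extChartAt_target_mem_nhds (I := 𝓘(ℂ, E)) (1 : G)]
    with x hx hxt v
  rw [← fderiv_partial_snd hx]
  have hs : (chartOne E G).symm x ∈ (chartOne E G).source := (chartOne E G).map_target hxt
  have := fderiv_chartOne_comp (E := E) (f := fun y : G => (chartOne E G).symm x * y)
    ((contMDiff_mul_left (n := ω)).mdifferentiable (by simp) 1)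
    (by simpa using hs) v
  refine Eq.trans ?_ this.symm
  rw [mpullbackWithin_apply]
  have i1 := mfderiv_extChartAt_comp_mfderivWithin_extChartAt_symm (I := 𝓘(ℂ, E)) hxt
  have i2 := mfderivWithin_extChartAt_symm_comp_mfderiv_extChartAt (I := 𝓘(ℂ, E)) hxt
  have i3 := ContinuousLinearMap.inverse_eq i2 i1
  rw [i3]
  have c : (mfderiv 𝓘(ℂ, E) 𝓘(ℂ, E) (chartOne E G) ((chartOne E G).symm x * 1) : E →L[ℂ] E) =
      mfderiv 𝓘(ℂ, E) 𝓘(ℂ, E) (chartOne E G) ((chartOne E G).symm x) := by rw [mul_one]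
  exact (DFunLike.congr_fun c _).symm

variable (G) in
/-- The bracket of the Lie algebra of `G`, regarded as an operation on the model space. -/
def lieOne (v w : E) : E :=
  Bracket.bracket (L := GroupLieAlgebra 𝓘(ℂ, E) G) (M := GroupLieAlgebra 𝓘(ℂ, E) G) v w

/-- The chart has derivative the identity at 1, so the bracket at 1 is the vector space bracket of
the left-invariant fields read in the chart. -/
theorem lie_eq_lieBracket (v w : E) :
    lieOne G v w =
      lieBracket ℂ (fun x => fderiv ℂ (mulChart E G) (x, chartOne E G 1) (0, v))
        (fun x => fderiv ℂ (mulChart E G) (x, chartOne E G 1) (0, w)) (chartOne E G 1) := by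
  set V := lieBracketWithin ℂ
    (mpullbackWithin 𝓘(ℂ, E) 𝓘(ℂ, E) (chartOne E G).symm
      (mulInvariantVectorField (I := 𝓘(ℂ, E)) (G := G) v) (range 𝓘(ℂ, E)))
    (mpullbackWithin 𝓘(ℂ, E) 𝓘(ℂ, E) (chartOne E G).symm
      (mulInvariantVectorField (I := 𝓘(ℂ, E)) (G := G) w) (range 𝓘(ℂ, E)))
    ((chartOne E G).symm ⁻¹' univ ∩ range 𝓘(ℂ, E)) (chartOne E G 1) with hV
  have h0 (A : E →L[ℂ] E) (hA : A = ContinuousLinearMap.id ℂ E) : A.inverse V = V := by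
    rw [hA, ContinuousLinearMap.inverse_id, ContinuousLinearMap.id_apply]
  refine (h0 _ mfderiv_chartOne).trans ?_
  have key (V W V' W' : E → E) (h1 : V =ᶠ[𝓝 (chartOne E G 1)] V')
      (h2 : W =ᶠ[𝓝 (chartOne E G 1)] W') :
      lieBracketWithin ℂ V W ((chartOne E G).symm ⁻¹' univ ∩ range 𝓘(ℂ, E)) (chartOne E G 1) =
        lieBracket ℂ V' W' (chartOne E G 1) := by
    simp only [modelWithCornersSelf_coe, range_id, preimage_univ, univ_inter]
    rw [lieBracketWithin_univ]
    exact Filter.EventuallyEq.lieBracket_vectorField_eq h1 h2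
  have h := eventually_mpullbackWithin_mulInvariantVectorField_eq (E := E) (G := G)
  exact key _ _ _ _ (h.mono fun x hx => hx v) (h.mono fun x hx => hx w)

/-- This is (gxg⁻¹)g = gx. It holds only near the base point because gxg⁻¹ has to stay in the domain
of the chart. -/
theorem mulChart_conjChart :
    ∀ᶠ p in 𝓝 (chartOne E G 1, chartOne E G 1),
      mulChart E G (conjChart E G p, p.1) = mulChart E G p := by
  have hs : ∀ᶠ g in 𝓝 (1 : G), g ∈ (chartOne E G).source := extChartAt_source_mem_nhds (1 : G)
  have hc : ContinuousAt (fun p : E × E => (chartOne E G).symm p.1 * (chartOne E G).symm p.2 *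
      ((chartOne E G).symm p.1)⁻¹) (chartOne E G 1, chartOne E G 1) :=
    ((contMDiffAt_chartOne_symm_fst.mul contMDiffAt_chartOne_symm_snd).mul
      contMDiffAt_chartOne_symm_fst.inv).continuousAt
  have hc' := hc.tendsto
  simp only [chartOne_symm_self, mul_one, inv_one] at hc'
  filter_upwards [hc'.eventually hs] with p hp
  rw [mulChart, mulChart, conjChart, (chartOne E G).left_inv hp, inv_mul_cancel_right]

theorem conjChart_right_self (x : E) :
    conjChart E G (x, chartOne E G 1) = chartOne E G 1 := by
  rw [conjChart, chartOne_symm_self, mul_one, mul_inv_cancel]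

theorem mulChart_right_self :
    ∀ᶠ x in 𝓝 (chartOne E G 1), mulChart E G (x, chartOne E G 1) = x := by
  filter_upwards [extChartAt_target_mem_nhds (I := 𝓘(ℂ, E)) (1 : G)] with x hx
  rw [mulChart, chartOne_symm_self, mul_one, (chartOne E G).right_inv hx]

theorem fderiv_mulChart_fst (v : E) :
    fderiv ℂ (mulChart E G) (chartOne E G 1, chartOne E G 1) (v, 0) = v := by
  rw [← fderiv_partial_fst (contDiffAt_mulChart.differentiableAt (by simp)),
    Filter.EventuallyEq.fderiv_eq (f := id) mulChart_right_self, fderiv_id]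
  rfl

theorem contDiffAt_fderiv_conjChart (v : E) :
    ContDiffAt ℂ ω (fun x => fderiv ℂ (conjChart E G) (x, chartOne E G 1) (0, v))
      (chartOne E G 1) := by
  have h : ContDiffAt ℂ ω (fderiv ℂ (conjChart E G)) (chartOne E G 1, chartOne E G 1) :=
    contDiffAt_conjChart.fderiv_right (by simp)
  exact (h.comp (f := fun x : E => (x, chartOne E G 1)) (chartOne E G 1)
    (contDiffAt_id.prodMk contDiffAt_const)).clm_apply contDiffAt_const

/-- Derivative of (gyg⁻¹)g = gy in y at the identity: the right-invariant field of Ad(g)v agrees at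
g with the left-invariant field of v. Differentiating once more, in g, yields the derivative of Ad.
-/
theorem fderiv_conjChart_relation :
    ∀ᶠ x in 𝓝 (chartOne E G 1), ∀ v : E,
      fderiv ℂ (mulChart E G) (chartOne E G 1, x)
        (fderiv ℂ (conjChart E G) (x, chartOne E G 1) (0, v), 0) =
      fderiv ℂ (mulChart E G) (x, chartOne E G 1) (0, v) := by
  set e := chartOne E G 1 with he
  have h2 : Tendsto (fun x : E => (x, e)) (𝓝 e) (𝓝 (e, e)) :=
    (Continuous.prodMk_left e).tendsto _
  have h3 : Tendsto (fun x : E => (e, x)) (𝓝 e) (𝓝 (e, e)) :=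
    (Continuous.prodMk_right e).tendsto _
  have hm := eventually_differentiableAt_of_contDiffAt (contDiffAt_mulChart (E := E) (G := G))
  have hc := eventually_differentiableAt_of_contDiffAt (contDiffAt_conjChart (E := E) (G := G))
  filter_upwards [h2.eventually hm, h3.eventually hm, h2.eventually hc,
    h2.eventually (mulChart_conjChart (E := E) (G := G)).eventually_nhds] with x h1 h1' h4 h5 v
  rw [← fderiv_partial_snd h1]
  have h6 : Tendsto (fun y : E => (x, y)) (𝓝 e) (𝓝 (x, e)) :=
    (Continuous.prodMk_right x).tendsto _
  have h7 : (fun y => mulChart E G (conjChart E G (x, y), x)) =ᶠ[𝓝 e]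
      fun y => mulChart E G (x, y) := h6.eventually h5
  rw [← h7.fderiv_eq]
  have h8 : HasFDerivAt (fun y => conjChart E G (x, y)) _ e :=
    h4.hasFDerivAt.comp e (hasFDerivAt_prodMk_right x e)
  have h9 := HasFDerivAt.comp (g := mulChart E G) (f := fun y => (conjChart E G (x, y), x)) e
    (by rw [conjChart_right_self]; exact h1'.hasFDerivAt) (h8.prodMk (hasFDerivAt_const x e))
  exact (DFunLike.congr_fun h9.fderiv v).symm

/-- The differential at `1` of the adjoint representation is the bracket, in the chart. -/
theorem fderiv_fderiv_conjChart (v w : E) :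
    fderiv ℂ (fun x => fderiv ℂ (conjChart E G) (x, chartOne E G 1) (0, w)) (chartOne E G 1) v =
      lieOne G v w := by
  rw [lie_eq_lieBracket]
  set e := chartOne E G 1 with he
  have hM : ContDiffAt ℂ ω (fderiv ℂ (mulChart E G)) (e, e) :=
    contDiffAt_mulChart.fderiv_right (by simp)
  have hD := (hM.differentiableAt (by simp)).hasFDerivAt
  set D := fderiv ℂ (fderiv ℂ (mulChart E G)) (e, e) with hDdef
  have hsymm : IsSymmSndFDerivAt ℂ (mulChart E G) (e, e) :=
    contDiffAt_mulChart.isSymmSndFDerivAt (by simp)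
  have hl : HasFDerivAt (fun x => fderiv ℂ (mulChart E G) (x, e)) _ e :=
    HasFDerivAt.comp (g := fderiv ℂ (mulChart E G)) (f := fun x => (x, e)) e hD
      (hasFDerivAt_prodMk_left e e)
  have hr : HasFDerivAt (fun x => fderiv ℂ (mulChart E G) (e, x)) _ e :=
    HasFDerivAt.comp (g := fderiv ℂ (mulChart E G)) (f := fun x => (e, x)) e hD
      (hasFDerivAt_prodMk_right e e)
  have hV (u : E) : fderiv ℂ (fun x => fderiv ℂ (mulChart E G) (x, e) (0, u)) e =
      (D.comp (ContinuousLinearMap.inl ℂ E E)).flip (0, u) := by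
    have := (hl.clm_apply (hasFDerivAt_const ((0 : E), u) e)).fderiv
    rw [this]
    ext z
    simp
  rw [lieBracket, hV w, hV v]
  have hA : HasFDerivAt (fun x => fderiv ℂ (conjChart E G) (x, e) (0, w)) _ e :=
    ((contDiffAt_fderiv_conjChart (G := G) w).differentiableAt (by simp)).hasFDerivAt
  have hA1 (u : E) : fderiv ℂ (conjChart E G) (e, e) (0, u) = u := by
    have := eventually_adjointAction_eq (E := E) (G := G).self_of_nhds u
    rw [chartOne_symm_self] at this
    exact this.symm.trans (adjointAction_one_apply (E := E) (G := G) u)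
  have hVe (u : E) : fderiv ℂ (mulChart E G) (e, e) (0, u) = u := by
    have h := (fderiv_conjChart_relation (E := E) (G := G)).self_of_nhds u
    rw [← he, hA1] at h
    rw [← h]
    exact fderiv_mulChart_fst u
  have hL := hr.clm_apply (hA.prodMk (hasFDerivAt_const (0 : E) e))
  have hR := hl.clm_apply (hasFDerivAt_const ((0 : E), w) e)
  have heq := (fderiv_conjChart_relation (E := E) (G := G)).mono fun x hx => hx w
  have h10 := DFunLike.congr_fun (hL.unique (hR.congr_of_eventuallyEq heq)) v
  have h11 := fderiv_mulChart_fst (E := E) (G := G)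
    (fderiv ℂ (fun x => fderiv ℂ (conjChart E G) (x, e) (0, w)) e v)
  -- Symmetry of the second derivative turns the extra term of the product rule into the second half
  -- of the Lie bracket of vector fields.
  have h12 : D (0, v) (w, 0) = D (w, 0) (0, v) := hsymm _ _
  simp only [add_apply, ContinuousLinearMap.comp_apply,
    ContinuousLinearMap.prod_apply, ContinuousLinearMap.flip_apply, hA1,
    zero_apply, ContinuousLinearMap.inl_apply,
    ContinuousLinearMap.inr_apply, map_zero, zero_add] at h10
  rw [← he] at h11
  rw [hVe, hVe]
  simp only [ContinuousLinearMap.comp_apply, ContinuousLinearMap.flip_apply,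
    ContinuousLinearMap.inl_apply]
  rw [h11, h12] at h10
  rw [← h10]
  abel

end ChartAtOne

/-! ### The exponential as a limit of powers. -/

section ExpLimit

variable {A : Type*} [NormedRing A] [NormedAlgebra ℂ A]

/-- Telescoping. The assumption on the norm of 1 is an inequality so that operators on a trivial
space are included. -/
theorem norm_pow_sub_pow_le {a b : A} {M : ℝ} (h1 : ‖(1 : A)‖ ≤ 1) (hM : 1 ≤ M) (ha : ‖a‖ ≤ M)
    (hb : ‖b‖ ≤ M) (n : ℕ) : ‖a ^ n - b ^ n‖ ≤ n * M ^ n * ‖a - b‖ := by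
  have hM0 : 0 ≤ M := zero_le_one.trans hM
  have hpow (n : ℕ) : ‖b ^ n‖ ≤ M ^ n := by
    induction n with
    | zero => simpa using h1
    | succ n ih =>
      rw [pow_succ, pow_succ]
      exact (norm_mul_le _ _).trans (by gcongr)
  induction n with
  | zero => simp
  | succ n ih =>
    have e : a ^ (n + 1) - b ^ (n + 1) = a * (a ^ n - b ^ n) + (a - b) * b ^ n := by
      rw [pow_succ', pow_succ', mul_sub, sub_mul]; abel
    rw [e]
    calc _ ≤ ‖a‖ * ‖a ^ n - b ^ n‖ + ‖a - b‖ * ‖b ^ n‖ :=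
          (norm_add_le _ _).trans (add_le_add (norm_mul_le _ _) (norm_mul_le _ _))
      _ ≤ M * (n * M ^ n * ‖a - b‖) + ‖a - b‖ * M ^ n := by
          gcongr; exact hpow n
      _ ≤ M * (n * M ^ n * ‖a - b‖) + ‖a - b‖ * (M ^ n * M) := by
          gcongr; exact le_mul_of_one_le_right (by positivity) hM
      _ = _ := by push_cast; ring

variable [CompleteSpace A]

/-- If `n (aₙ - 1) → d` then `aₙⁿ → exp d`. -/
theorem tendsto_pow_exp {a : ℕ → A} {d : A} (h1 : ‖(1 : A)‖ ≤ 1)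
    (h : Tendsto (fun n : ℕ => (n : ℂ) • (a n - 1)) atTop (𝓝 d)) :
    Tendsto (fun n : ℕ => a n ^ n) atTop (𝓝 (NormedSpace.exp d)) := by
  -- The model sequence: its n-th powers equal exp d exactly and it has the same first-order
  -- behaviour as `a`, so only the difference of the powers has to be estimated.
  set b : ℕ → A := fun n => NormedSpace.exp ((n : ℂ)⁻¹ • d) with hb
  have hbn : ∀ᶠ n : ℕ in atTop, b n ^ n = NormedSpace.exp d := by
    filter_upwards [eventually_gt_atTop 0] with n hn
    have hn' : (n : ℂ) ≠ 0 := by exact_mod_cast hn.ne'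
    rw [hb]
    let : NormedAlgebra ℚ A := NormedAlgebra.restrictScalars ℚ ℂ A
    rw [← NormedSpace.exp_nsmul, ← Nat.cast_smul_eq_nsmul ℂ, smul_smul, mul_inv_cancel₀ hn',
      one_smul]
  have hb1 : Tendsto (fun n : ℕ => (n : ℂ) • (b n - 1)) atTop (𝓝 d) := by
    have hd := hasDerivAt_exp_smul_const (𝕂 := ℂ) d (0 : ℂ)
    rw [zero_smul, NormedSpace.exp_zero, one_mul] at hd
    have hs := hd.tendsto_slope_zero
    have hlim : Tendsto (fun n : ℕ => (n : ℂ)⁻¹) atTop (𝓝[≠] 0) := by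
      rw [tendsto_nhdsWithin_iff]
      refine ⟨tendsto_inv_atTop_nhds_zero_nat, ?_⟩
      filter_upwards [eventually_gt_atTop 0] with n hn
      simpa using hn.ne'
    have := hs.comp hlim
    refine this.congr fun n => ?_
    simp [hb]
  -- Any constant above the norm of `d` works: both sequences are eventually bounded by exp(c/n),
  -- whose n-th power is independent of n.
  set c := ‖d‖ + 1 with hc
  have hbound {f : ℕ → A} (hf : Tendsto (fun n : ℕ => (n : ℂ) • (f n - 1)) atTop (𝓝 d)) :
      ∀ᶠ n : ℕ in atTop, ‖f n‖ ≤ Real.exp (c / n) := by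
    filter_upwards [eventually_gt_atTop 0,
      hf.norm.eventually (gt_mem_nhds (show ‖d‖ < c by simp [hc]))] with n hn hlt
    have hn' : (0 : ℝ) < n := by exact_mod_cast hn
    rw [norm_smul, Complex.norm_natCast] at hlt
    have h2 : ‖f n - 1‖ ≤ c / n := by rw [le_div_iff₀ hn']; linarith
    calc ‖f n‖ = ‖(f n - 1) + 1‖ := by rw [sub_add_cancel]
      _ ≤ ‖f n - 1‖ + ‖(1 : A)‖ := norm_add_le _ _
      _ ≤ c / n + 1 := add_le_add h2 h1
      _ ≤ _ := Real.add_one_le_exp _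
  have hdiff : Tendsto (fun n : ℕ => a n ^ n - b n ^ n) atTop (𝓝 0) := by
    have hz : Tendsto (fun n : ℕ => Real.exp c * ‖(n : ℂ) • (a n - 1) - (n : ℂ) • (b n - 1)‖)
        atTop (𝓝 0) := by
      simpa using ((h.sub hb1).norm).const_mul (Real.exp c)
    refine squeeze_zero_norm' ?_ hz
    filter_upwards [hbound h, hbound hb1, eventually_gt_atTop 0] with n ha' hb' hn
    have hn' : (0 : ℝ) < n := by exact_mod_cast hn
    have h3 : Real.exp (c / n) ^ n = Real.exp c := by
      rw [← Real.exp_nat_mul]; congr 1; field_simp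
    have h4 := norm_pow_sub_pow_le h1 (Real.one_le_exp (by positivity)) ha' hb' n
    rw [h3] at h4
    refine h4.trans_eq ?_
    rw [← smul_sub, norm_smul, Complex.norm_natCast, sub_sub_sub_cancel_right]
    ring
  have := (hdiff.add (tendsto_const_nhds (x := NormedSpace.exp d))).congr' (f₂ := fun n => a n ^ n)
    (by filter_upwards [hbn] with n hn; rw [hn, sub_add_cancel])
  simpa using this

theorem exp_apply_of_apply_eq_smul {E : Type*} [NormedAddCommGroup E] [NormedSpace ℂ E]
    [CompleteSpace E] {T : E →L[ℂ] E} {v : E} {c : ℂ} (h : T v = c • v) :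
    NormedSpace.exp T v = Complex.exp c • v := by
  have hn (n : ℕ) : (T ^ n) v = c ^ n • v := by
    induction n with
    | zero => simp
    | succ n ih => rw [pow_succ, mul_apply_eq_comp, h, map_smul, ih, smul_smul,
        pow_succ, mul_comm]
  have h1 := (NormedSpace.exp_series_hasSum_exp' (𝕂 := ℂ) T).mapL
    (ContinuousLinearMap.apply ℂ E v)
  have h2 := (NormedSpace.exp_series_hasSum_exp' (𝕂 := ℂ) c).smul_const v
  rw [← Complex.exp_eq_exp_ℂ] at h2
  refine h1.unique ?_
  convert h2 using 2 with n
  simp [hn, smul_smul]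

end ExpLimit

/-! ### The flow of `ad Z` inside Ad(`G`)-stable sets, and holomorphy of Ad. -/

section AdjointExp

variable {E : Type*} [NormedAddCommGroup E] [NormedSpace ℂ E]
  {G : Type*} [TopologicalSpace G] [ChartedSpace E G] [Group G]
variable [CompleteSpace E] [LieGroup 𝓘(ℂ, E) ω G]

/-- A closed set that is stable under the adjoint action of `G` is stable under `exp (ad Z)`. -/
theorem exp_ad_mem_of_isClosed {C : Set E} (hC : IsClosed C)
    (hG : ∀ (g : G), ∀ Y ∈ C, (adjointAction g Y : E) ∈ C) (Z : E) :
    ∃ T : E →L[ℂ] E, (∀ w, T w = lieOne G Z w) ∧ ∀ Y ∈ C, NormedSpace.exp T Y ∈ C := by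
  set e := chartOne E G 1 with he
  set A : E → (E →L[ℂ] E) := fun x =>
    (fderiv ℂ (conjChart E G) (x, e)).comp (ContinuousLinearMap.inr ℂ E E) with hA
  have h : ContDiffAt ℂ ω (fderiv ℂ (conjChart E G)) (e, e) :=
    contDiffAt_conjChart.fderiv_right (by simp)
  have hd : DifferentiableAt ℂ A e :=
    ((h.comp (f := fun x : E => (x, e)) e
      (contDiffAt_id.prodMk contDiffAt_const)).clm_comp contDiffAt_const).differentiableAt
      (by simp)
  have hAw (w : E) : (fun x => A x w) = fun x => fderiv ℂ (conjChart E G) (x, e) (0, w) := by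
    ext x; simp [hA]
  refine ⟨fderiv ℂ A e Z, fun w => ?_, fun Y hY => ?_⟩
  · rw [← fderiv_fderiv_conjChart, ← he, ← hAw,
      (hd.hasFDerivAt.clm_apply (hasFDerivAt_const w e)).fderiv]
    simp
  · have hline : HasDerivAt (fun t : ℂ => A (e + t • Z)) (fderiv ℂ A e Z) 0 := by
      have h1 : HasDerivAt (fun t : ℂ => e + t • Z) Z 0 := by
        simpa using ((hasDerivAt_id (0 : ℂ)).smul_const Z).const_add e
      exact HasFDerivAt.comp_hasDerivAt (0 : ℂ) (by simpa using hd.hasFDerivAt) h1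
    have hAe : A e = 1 := by
      ext u
      have := eventually_adjointAction_eq (E := E) (G := G).self_of_nhds u
      rw [chartOne_symm_self] at this
      have h5 := this.symm.trans (adjointAction_one_apply (E := E) (G := G) u)
      exact (congrFun (hAw u) e).trans h5
    have hlim0 : Tendsto (fun n : ℕ => (n : ℂ)⁻¹) atTop (𝓝[≠] 0) := by
      rw [tendsto_nhdsWithin_iff]
      refine ⟨tendsto_inv_atTop_nhds_zero_nat, ?_⟩
      filter_upwards [eventually_gt_atTop 0] with n hn
      simpa using hn.ne'
    have hseq : Tendsto (fun n : ℕ => (n : ℂ) • (A (e + (n : ℂ)⁻¹ • Z) - 1)) atTop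
        (𝓝 (fderiv ℂ A e Z)) := by
      refine (hline.tendsto_slope_zero.comp hlim0).congr fun n => ?_
      simp [hAe]
    -- The operator exp(ad Z) is the limit of n-th powers of Ad of the group element with chart
    -- coordinate e + Z/n.
    have hpow := tendsto_pow_exp ContinuousLinearMap.norm_id_le hseq
    have hev : ∀ᶠ n : ℕ in atTop, ∀ v : E, (adjointAction ((chartOne E G).symm
        (e + (n : ℂ)⁻¹ • Z)) v : E) = A (e + (n : ℂ)⁻¹ • Z) v := by
      have ht : Tendsto (fun n : ℕ => e + (n : ℂ)⁻¹ • Z) atTop (𝓝 e) := by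
        have := ((tendsto_inv_atTop_nhds_zero_nat (𝕜 := ℂ)).smul_const Z).const_add e
        simpa using this
      filter_upwards [ht.eventually (eventually_adjointAction_eq (E := E) (G := G))] with n hn v
      rw [hn v]
      exact (congrFun (hAw v) _).symm
    refine hC.mem_of_tendsto (((ContinuousLinearMap.apply ℂ E Y).continuous.tendsto _).comp hpow) ?_
    filter_upwards [hev] with n hn
    have : ∀ m : ℕ, (A (e + (n : ℂ)⁻¹ • Z) ^ m) Y ∈ C := by
      intro m
      induction m with
      | zero => simpa using hY
      | succ m ih =>
        rw [pow_succ', mul_apply_eq_comp, ← hn]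
        exact hG _ _ ih
    exact this n

/-- The adjoint action, regarded as an operator on the model space. -/
def adjointOne (g : G) : E →L[ℂ] E := adjointAction g

/-- Near 1 this is smoothness of the partial derivative of conjugation in the chart; Ad(g) = Ad(g₀)
Ad(g₀⁻¹g) carries it to every other point. -/
theorem contMDiff_adjointAction_apply (w : E) :
    ContMDiff 𝓘(ℂ, E) 𝓘(ℂ, E) ω (fun g : G => adjointOne g w) := by
  have h1 : ContMDiffAt 𝓘(ℂ, E) 𝓘(ℂ, E) ω (fun g : G => adjointOne g w) 1 := by
    have h := (contDiffAt_fderiv_conjChart (G := G) w).contMDiffAt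
    have h2 := ContMDiffAt.comp (1 : G) (g := fun x => fderiv ℂ (conjChart E G)
      (x, chartOne E G 1) (0, w)) (f := chartOne E G) h contMDiffAt_chartOne
    refine h2.congr_of_eventuallyEq ?_
    filter_upwards [(continuousAt_extChartAt (I := 𝓘(ℂ, E)) (1 : G)).tendsto.eventually
      (eventually_adjointAction_eq (E := E) (G := G)),
      extChartAt_source_mem_nhds (I := 𝓘(ℂ, E)) (1 : G)] with g hg hs
    have := hg w
    rw [(chartOne E G).left_inv hs] at this
    exact this
  intro g₀
  have h2 : ContMDiffAt 𝓘(ℂ, E) 𝓘(ℂ, E) ω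
      (fun g : G => adjointOne (g₀⁻¹ * g) w) g₀ :=
    ContMDiffAt.comp_of_eq (y := (1 : G)) (g := fun g : G => adjointOne g w)
      (f := fun g => g₀⁻¹ * g) h1 (contMDiff_mul_left (n := ω) g₀) (by simp)
  have h3 := ContMDiffAt.comp g₀ (g := fun v : E => adjointOne g₀ v)
    (f := fun g : G => adjointOne (g₀⁻¹ * g) w)
    (adjointOne g₀ : E →L[ℂ] E).contMDiff.contMDiffAt h2
  refine h3.congr_of_eventuallyEq (Eventually.of_forall fun g => ?_)
  have := adjointAction_mul_apply (E := E) g₀ (g₀⁻¹ * g) w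
  rw [mul_inv_cancel_left] at this
  exact this

end AdjointExp

/-! ### The identity theorem on a connected complex manifold. -/

section IdentityTheorem

variable {E : Type*} [NormedAddCommGroup E] [NormedSpace ℂ E] [CompleteSpace E]
  {M : Type*} [TopologicalSpace M] [ChartedSpace E M] [IsManifold 𝓘(ℂ, E) ω M]
  [PreconnectedSpace M]

/-- A holomorphic function on a connected manifold that does not vanish identically is nonzero
on a dense set. -/
theorem dense_ne_zero_of_contMDiff {f : M → ℂ} (hf : ContMDiff 𝓘(ℂ, E) 𝓘(ℂ, ℂ) ω f) {x₀ : M}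
    (hx₀ : f x₀ ≠ 0) : Dense {x | f x ≠ 0} := by
  -- The points where the germ of `f` vanishes form a clopen set: closedness is the identity theorem
  -- on a ball in a chart. If the nonvanishing locus were not dense, this set would be everything.
  set Z : Set M := {x | f =ᶠ[𝓝 x] 0} with hZ
  have hopen : IsOpen Z := isOpen_setOfPred_eventually_nhds
  have hclosed : IsClosed Z := by
    refine isClosed_of_closure_subset fun x hx => ?_
    set φ := extChartAt 𝓘(ℂ, E) x with hφ
    obtain ⟨r, hr, hball⟩ := Metric.isOpen_iff.1 (isOpen_extChartAt_target (I := 𝓘(ℂ, E)) x)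
      (φ x) (mem_extChartAt_target x)
    have hcont : ContinuousOn φ.symm φ.target := continuousOn_extChartAt_symm x
    have han : AnalyticOnNhd ℂ (f ∘ φ.symm) (Metric.ball (φ x) r) := by
      intro y hy
      have h1 : ContMDiffAt 𝓘(ℂ, E) 𝓘(ℂ, E) ω φ.symm y :=
        (contMDiffOn_extChartAt_symm x).contMDiffAt
          ((isOpen_extChartAt_target (I := 𝓘(ℂ, E)) x).mem_nhds (hball hy))
      exact (contMDiffAt_iff_contDiffAt.1 ((hf _).comp y h1)).analyticAt
    have hnear : φ ⁻¹' Metric.ball (φ x) r ∩ φ.source ∈ 𝓝 x :=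
      inter_mem ((continuousAt_extChartAt x).preimage_mem_nhds (Metric.ball_mem_nhds _ hr))
        (extChartAt_source_mem_nhds x)
    obtain ⟨y, ⟨hy1, hy2⟩, hyZ⟩ := mem_closure_iff_nhds.1 hx _ hnear
    have hev : (f ∘ φ.symm) =ᶠ[𝓝 (φ y)] 0 := by
      have : Tendsto φ.symm (𝓝 (φ y)) (𝓝 y) := by
        have := (hcont.continuousAt ((isOpen_extChartAt_target (I := 𝓘(ℂ, E)) x).mem_nhds
          (φ.map_source hy2))).tendsto
        rwa [φ.left_inv hy2] at this
      exact this.eventually hyZ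
    have heq := han.eqOn_zero_of_preconnected_of_eventuallyEq_zero
      (convex_ball _ _).isPreconnected hy1 hev
    filter_upwards [hnear] with z hz
    have := heq hz.1
    simpa [φ.left_inv hz.2] using this
  by_contra hd
  rw [dense_iff_inter_open] at hd
  push Not at hd
  obtain ⟨U, hU, ⟨y, hy⟩, hemp⟩ := hd
  have hyZ : y ∈ Z := by
    filter_upwards [hU.mem_nhds hy] with z hz
    by_contra hne
    have : z ∈ U ∩ {x | f x ≠ 0} := ⟨hz, hne⟩
    rw [hemp] at this
    exact this
  have huniv : Z = univ := IsClopen.eq_univ ⟨hclosed, hopen⟩ ⟨y, hyZ⟩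
  have : x₀ ∈ Z := huniv ▸ mem_univ x₀
  exact hx₀ this.self_of_nhds

end IdentityTheorem

/-! ### The Lie algebra of a subgroup of fixed points. -/

section SubgroupLieAlgebra

variable {E : Type*} [NormedAddCommGroup E] [NormedSpace ℂ E]
  {G : Type*} [TopologicalSpace G] [ChartedSpace E G] [Group G]
variable [CompleteSpace E] [LieGroup 𝓘(ℂ, E) ω G]

theorem adjointAction_mem_subgroupLieAlgebra {H : Subgroup G} {h : G} (hh : h ∈ H)
    {X : GroupLieAlgebra 𝓘(ℂ, E) G} (hX : X ∈ subgroupLieAlgebra (E := E) H) :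
    adjointAction h X ∈ subgroupLieAlgebra (E := E) H := by
  induction hX using Submodule.span_induction with
  | zero => rw [map_zero]; exact zero_mem _
  | add x y _ _ hx hy => rw [map_add]; exact add_mem hx hy
  | smul a x _ hx => rw [map_smul]; exact Submodule.smul_mem _ _ hx
  | mem X hX =>
    obtain ⟨c, hcH, hc0, hc, rfl⟩ := hX
    refine Submodule.subset_span ⟨fun z => h * c z * h⁻¹,
      fun z => H.mul_mem (H.mul_mem hh (hcH z)) (H.inv_mem hh), by simp [hc0], ?_, ?_⟩
    · exact ContMDiffAt.comp (0 : ℂ) (contMDiff_conj (E := E) h _) hc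
    · have hcm := mfderiv_comp (0 : ℂ) (g := fun x : G => h * x * h⁻¹) (f := c)
        (I := 𝓘(ℂ, ℂ)) (I' := 𝓘(ℂ, E)) (I'' := 𝓘(ℂ, E))
        ((contMDiff_conj (E := E) h).mdifferentiable (by simp) _)
        (hc.mdifferentiableAt (by simp))
      have h1 : (mfderiv 𝓘(ℂ, E) 𝓘(ℂ, E) (fun x : G => h * x * h⁻¹) (c 0) : E →L[ℂ] E) =
          adjointAction h := by rw [hc0]; rfl
      exact ((DFunLike.congr_fun hcm (1 : ℂ)).trans (DFunLike.congr_fun h1 _)).symm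

/-- The endomorphism `θ` of `G` read in the chart at the identity. -/
def homChart (θ : G →* G) (x : E) : E := chartOne E G (θ ((chartOne E G).symm x))

theorem homChart_self (θ : G →* G) : homChart (E := E) θ (chartOne E G 1) = chartOne E G 1 := by
  rw [homChart, chartOne_symm_self, map_one]

theorem contDiffAt_homChart {θ : G →* G} (hθ : ContMDiff 𝓘(ℂ, E) 𝓘(ℂ, E) ω θ) :
    ContDiffAt ℂ ω (homChart (E := E) θ) (chartOne E G 1) := by
  rw [← contMDiffAt_iff_contDiffAt]
  refine ContMDiffAt.comp_of_eq (I' := 𝓘(ℂ, E)) (g := chartOne E G)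
    (y := 1) contMDiffAt_chartOne ((hθ _).comp _ contMDiffAt_chartOne_symm) ?_
  simp

theorem fderiv_homChart {θ : G →* G} (hθ : ContMDiff 𝓘(ℂ, E) 𝓘(ℂ, E) ω θ) :
    fderiv ℂ (homChart (E := E) θ) (chartOne E G 1) = (lieDifferential θ : E →L[ℂ] E) := by
  ext v
  exact fderiv_chartOne_comp_of_map_one (hθ.mdifferentiable (by simp) 1) (map_one θ) v

/-- The fixed vectors of the differential of an involution `θ` belong to the Lie algebra of every
subgroup that contains the identity component of the fixed points of `θ`. -/
theorem mem_subgroupLieAlgebra_of_lieDifferential_eq {θ : G →* G}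
    (hθ : ContMDiff 𝓘(ℂ, E) 𝓘(ℂ, E) ω θ) (hinv : Function.Involutive θ) {K : Subgroup G}
    (hK₀ : connectedComponentIn {g : G | θ g = g} 1 ⊆ (K : Set G))
    {X : GroupLieAlgebra 𝓘(ℂ, E) G} (hX : lieDifferential θ X = X) :
    X ∈ subgroupLieAlgebra (E := E) K := by
  set e := chartOne E G 1 with he
  set T : E →L[ℂ] E := lieDifferential θ with hT
  set F : E → E := homChart θ with hF
  have hTT (v : E) : T (T v) = v := by
    have := lieDifferential_comp_apply (E := E) hθ hθ v
    rw [show θ.comp θ = MonoidHom.id G from MonoidHom.ext hinv, ] at this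
    exact this.symm.trans (lieDifferential_id_apply (E := E) (G := G) v)
  obtain ⟨Y, hY⟩ : ∃ Y : E, Y = X := ⟨X, rfl⟩
  have hTY : T Y = Y := by rw [hY]; exact hX
  have hFe : F e = e := homChart_self θ
  have hFd : ContDiffAt ℂ ω F e := contDiffAt_homChart hθ
  have hFf : HasFDerivAt F T e := by
    rw [hT, ← fderiv_homChart hθ]
    exact (hFd.differentiableAt (by simp)).hasFDerivAt
  -- Linearization by averaging over the group generated by the involution: near e, ψ ∘ F = T ∘ ψ.
  -- As ψ has derivative the identity at e, it is a local coordinate in which `θ` is linear.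
  set ψ : E → E := fun x => (2⁻¹ : ℂ) • ((x - e) + T (F x - e)) with hψ
  have hψe : ψ e = 0 := by simp [hψ, hFe]
  have hψd : ContDiffAt ℂ ω ψ e :=
    ((contDiffAt_id.sub contDiffAt_const).add
      (T.contDiff.contDiffAt.comp e (hFd.sub contDiffAt_const))).const_smul _
  have hψf : HasFDerivAt ψ ((ContinuousLinearEquiv.refl ℂ E : E ≃L[ℂ] E) : E →L[ℂ] E) e := by
    have h1 := (((hasFDerivAt_id (𝕜 := ℂ) e).sub_const e).add
      (T.hasFDerivAt.comp e (hFf.sub_const e))).const_smul (2⁻¹ : ℂ)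
    refine h1.congr_fderiv ?_
    ext v
    simp only [FunLike.coe_smul, Pi.smul_apply, add_apply, ContinuousLinearMap.id_apply,
      ContinuousLinearMap.comp_apply, hTT, ContinuousLinearEquiv.coe_coe,
      ContinuousLinearEquiv.refl_apply]
    rw [← two_smul ℂ v, smul_smul]
    norm_num
  have hω : (ω : WithTop ℕ∞) ≠ 0 := by simp
  set Ψ := hψd.toOpenPartialHomeomorph ψ hψf hω with hΨ
  have hΨc : (Ψ : E → E) = ψ := hψd.toOpenPartialHomeomorph_coe hψf hω
  have hes : e ∈ Ψ.source := hψd.mem_toOpenPartialHomeomorph_source hψf hω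
  have h0t : (0 : E) ∈ Ψ.target := by
    rw [← hψe, ← hΨc]; exact Ψ.map_source hes
  have hsymm0 : Ψ.symm 0 = e := by
    rw [← hψe, ← hΨc]; exact Ψ.left_inv hes
  have hsymmd : ContDiffAt ℂ ω Ψ.symm 0 := by
    have := hψd.to_localInverse hψf hω
    rwa [hψe] at this
  have hsymmf : HasFDerivAt Ψ.symm (ContinuousLinearMap.id ℂ E) 0 := by
    have h2 := Ψ.hasFDerivAt_symm (a := 0) (f' := ContinuousLinearEquiv.refl ℂ E) h0t
      (by rw [hsymm0, hΨc]; exact hψf)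
    exact h2
  -- the fixed points near `e`
  have hsrc : ∀ᶠ y in 𝓝 e, y ∈ Ψ.source := Ψ.open_source.mem_nhds hes
  have htgt : ∀ᶠ y in 𝓝 e, y ∈ (chartOne E G).target := extChartAt_target_mem_nhds (1 : G)
  have hFt : Tendsto F (𝓝 e) (𝓝 e) := by
    have := hFd.continuousAt.tendsto; rwa [hFe] at this
  have hθs : ∀ᶠ y in 𝓝 e, θ ((chartOne E G).symm y) ∈ (chartOne E G).source := by
    have h1 : Tendsto (fun y => θ ((chartOne E G).symm y)) (𝓝 e) (𝓝 1) := by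
      have := (hθ.continuous.tendsto 1).comp (tendsto_chartOne_symm (E := E) (G := G))
      rwa [map_one] at this
    exact h1.eventually (extChartAt_source_mem_nhds (1 : G))
  have hfix : ∀ᶠ y in 𝓝 e, T (ψ y) = ψ y →
      θ ((chartOne E G).symm y) = (chartOne E G).symm y := by
    filter_upwards [hsrc, htgt, hθs, hFt.eventually hsrc] with y h1 h2 h3 h4 hy
    have hFF : F (F y) = y := by
      simp only [hF, homChart]
      rw [(chartOne E G).left_inv h3, hinv, (chartOne E G).right_inv h2]
    have hψF : ψ (F y) = ψ y := by
      rw [← hy]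
      simp only [hψ, hFF, map_smul, map_add, hTT, add_comm]
    have hFy : F y = y := by
      rw [← hΨc] at hψF
      exact Ψ.injOn h4 h1 hψF
    have h5 := congrArg (chartOne E G).symm hFy
    simp only [hF, homChart] at h5
    rwa [(chartOne E G).left_inv h3] at h5
  -- the curve
  set γ : ℂ → E := fun z => Ψ.symm (z • Y) with hγ
  have hγ0 : γ 0 = e := by simp only [hγ]; rw [zero_smul]; exact hsymm0
  have hlin : HasDerivAt (fun z : ℂ => z • Y) Y 0 := by
    simpa using (hasDerivAt_id (0 : ℂ)).smul_const Y
  have hlint : Tendsto (fun z : ℂ => z • Y) (𝓝 0) (𝓝 0) := by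
    have := hlin.continuousAt.tendsto
    rwa [zero_smul] at this
  have hγd : ContDiffAt ℂ ω γ 0 :=
    ContDiffAt.comp (g := Ψ.symm) (f := fun z : ℂ => z • Y) 0
      (by rw [zero_smul]; exact hsymmd) (contDiffAt_id.smul contDiffAt_const)
  have hγf : HasDerivAt γ Y 0 :=
    HasFDerivAt.comp_hasDerivAt (l := Ψ.symm) (f := fun z : ℂ => z • Y) (0 : ℂ)
      (l' := ContinuousLinearMap.id ℂ E) (by rw [zero_smul]; exact hsymmf) hlin
  have hγt : Tendsto γ (𝓝 0) (𝓝 e) := by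
    have := hγd.continuousAt.tendsto; rwa [hγ0] at this
  have hcd : ContMDiffAt 𝓘(ℂ, ℂ) 𝓘(ℂ, E) ω (fun z => (chartOne E G).symm (γ z)) 0 :=
    ContMDiffAt.comp_of_eq (y := e) contMDiffAt_chartOne_symm hγd.contMDiffAt hγ0
  have hgood : ∀ᶠ z in 𝓝 (0 : ℂ), θ ((chartOne E G).symm (γ z)) = (chartOne E G).symm (γ z) ∧
      ContinuousAt (fun z => (chartOne E G).symm (γ z)) z := by
    have hcont : ∀ᶠ z in 𝓝 (0 : ℂ), ContinuousAt (fun z => (chartOne E G).symm (γ z)) z := by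
      filter_upwards [hγd.eventually (by simp),
        hγt.eventually ((isOpen_extChartAt_target (I := 𝓘(ℂ, E)) (1 : G)).mem_nhds
          (mem_extChartAt_target (1 : G)))] with z h1 h2
      exact ContinuousAt.comp (g := (chartOne E G).symm)
        ((continuousOn_extChartAt_symm (I := 𝓘(ℂ, E)) (1 : G)).continuousAt
          ((isOpen_extChartAt_target (I := 𝓘(ℂ, E)) (1 : G)).mem_nhds h2)) h1.continuousAt
    filter_upwards [hγt.eventually hfix, hlint.eventually (Ψ.open_target.mem_nhds h0t), hcont]
      with z h1 h2 h3
    refine ⟨h1 ?_, h3⟩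
    have h4 : ψ (γ z) = z • Y := by rw [← hΨc]; exact Ψ.right_inv h2
    rw [h4]
    rw [map_smul, hTY]
  obtain ⟨r, hr, hball⟩ := Metric.eventually_nhds_iff_ball.1 hgood
  classical
  -- The curve must lie in `K` for every z, so it is set to 1 away from the ball where the local
  -- construction makes sense.
  set c : ℂ → G := fun z => if z ∈ Metric.ball (0 : ℂ) r then (chartOne E G).symm (γ z) else 1
    with hc
  have hceq : c =ᶠ[𝓝 0] fun z => (chartOne E G).symm (γ z) := by
    filter_upwards [Metric.ball_mem_nhds (0 : ℂ) hr] with z hz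
    simp only [hc, if_pos hz]
  have h00 : (chartOne E G).symm (γ 0) = 1 := by rw [hγ0]; exact chartOne_symm_self
  -- The image of the ball is connected, consists of fixed points and contains 1, so it lies in the
  -- identity component and hence in `K`.
  have himage : (fun z => (chartOne E G).symm (γ z)) '' Metric.ball (0 : ℂ) r ⊆
      connectedComponentIn {g : G | θ g = g} 1 := by
    refine IsPreconnected.subset_connectedComponentIn ?_ ?_ ?_
    · exact (convex_ball (0 : ℂ) r).isPreconnected.image _
        fun z hz => (hball z hz).2.continuousWithinAt
    · exact ⟨0, Metric.mem_ball_self hr, h00⟩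
    · rintro _ ⟨z, hz, rfl⟩
      exact (hball z hz).1
  refine Submodule.subset_span ⟨c, fun z => ?_, ?_, hcd.congr_of_eventuallyEq hceq, ?_⟩
  · by_cases hz : z ∈ Metric.ball (0 : ℂ) r
    · simp only [hc, if_pos hz]
      exact hK₀ (himage ⟨z, hz, rfl⟩)
    · simp only [hc, if_neg hz]
      exact K.one_mem
  · simp only [hc, if_pos (Metric.mem_ball_self hr)]
    exact h00
  · have h1 := hceq.mfderiv_eq (I := 𝓘(ℂ, ℂ)) (I' := 𝓘(ℂ, E))
    have h2 := mfderiv_comp (0 : ℂ) (g := (chartOne E G).symm) (f := γ)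
      (I := 𝓘(ℂ, ℂ)) (I' := 𝓘(ℂ, E)) (I'' := 𝓘(ℂ, E))
      (by rw [hγ0]; exact contMDiffAt_chartOne_symm.mdifferentiableAt (by simp))
      (hγd.contMDiffAt.mdifferentiableAt (by simp))
    have h3 : (mfderiv 𝓘(ℂ, E) 𝓘(ℂ, E) (chartOne E G).symm (γ 0) : E →L[ℂ] E) =
        ContinuousLinearMap.id ℂ E := by rw [hγ0]; exact mfderiv_chartOne_symm
    have h4 : (fderiv ℂ γ 0 : ℂ →L[ℂ] E) 1 = Y := hγf.deriv
    rw [← mfderiv_eq_fderiv] at h4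
    have h5 : (show E from mfderiv 𝓘(ℂ, ℂ) 𝓘(ℂ, E) c 0 (show ℂ from 1)) =
        (show E from mfderiv 𝓘(ℂ, ℂ) 𝓘(ℂ, E) (fun z => (chartOne E G).symm (γ z)) 0
          (show ℂ from 1)) := by
      rw [h1]; rfl
    exact ((h5.trans (DFunLike.congr_fun h2 (1 : ℂ))).trans
      ((DFunLike.congr_fun h3 _).trans (h4.trans hY))).symm

end SubgroupLieAlgebra

/-! ### Simultaneous diagonalization of symmetric operators. -/

section JointEigenbasis

/-- Commuting operators that are symmetric for a positive definite form have a common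
eigenbasis. -/
theorem exists_basis_joint_eigenvectors {V : Type*} [AddCommGroup V] [Module ℝ V]
    [FiniteDimensional ℝ V] (B : V →ₗ[ℝ] V →ₗ[ℝ] ℝ) (hsymm : ∀ x y, B x y = B y x)
    (hpos : ∀ x, x ≠ 0 → 0 < B x x) {κ : Type*} (T : κ → V →ₗ[ℝ] V)
    (hT : ∀ k x y, B (T k x) y = B x (T k y)) (hC : ∀ k l, Commute (T k) (T l)) :
    ∃ (n : ℕ) (b : Module.Basis (Fin n) ℝ V), ∀ i k, ∃ c : ℝ, T k (b i) = c • b i := by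
  let core : InnerProductSpace.Core ℝ V :=
    { inner := fun x y => B x y
      conj_inner_symm := fun x y => hsymm y x
      re_inner_nonneg := fun x => by
        by_cases hx : x = 0
        · simp [hx]
        · exact (hpos x hx).le
      add_left := fun x y z => by simp
      smul_left := fun x y r => by simp
      definite := fun x hx => by
        by_contra hne
        exact (hpos x hne).ne' hx }
  let : NormedAddCommGroup V := core.toNormedAddCommGroup
  let : InnerProductSpace ℝ V := InnerProductSpace.ofCore core.toCore
  have hS (k : κ) : (T k).IsSymmetric := fun x y => hT k x y
  have htop := LinearMap.IsSymmetric.iSup_iInf_eq_top_of_commute hS fun k l _ => hC k l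
  set s : Set V := ⋃ χ : κ → ℝ, ((⨅ k, Module.End.eigenspace (T k) (χ k) : Submodule ℝ V) : Set V)
  have hs : ⊤ ≤ Submodule.span ℝ s := by
    rw [← htop]
    exact iSup_le fun χ => (Set.subset_iUnion (fun χ : κ → ℝ =>
      ((⨅ k, Module.End.eigenspace (T k) (χ k) : Submodule ℝ V) : Set V)) χ).trans
      Submodule.subset_span
  set b := Module.Basis.ofSpan hs
  have hfin := Module.Finite.finite_basis b
  have := Fintype.ofFinite (LinearIndepOn.extend (linearIndepOn_empty ℝ id)
    (Set.empty_subset s))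
  refine ⟨_, b.reindex (Fintype.equivFin _), fun i k => ?_⟩
  obtain ⟨j, rfl⟩ := (Fintype.equivFin _).surjective i
  have hb : b j ∈ s := Module.Basis.ofSpan_subset hs ⟨j, rfl⟩
  obtain ⟨χ, hχ⟩ := Set.mem_iUnion.1 hb
  refine ⟨χ k, ?_⟩
  rw [Module.Basis.reindex_apply, Equiv.symm_apply_apply]
  exact Module.End.mem_eigenspace_iff.1 ((Submodule.mem_iInf _).1 hχ k)

end JointEigenbasis

/-! ### Restricted weights and the Iwasawa decomposition. -/

section CartanInvolution

variable {𝔰 : Type*} [LieRing 𝔰] [LieAlgebra ℝ 𝔰] [FiniteDimensional ℝ 𝔰]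

/-- A maximal element exists by finite dimension; adjoining a commuting anti-fixed `z` would keep
both properties and contradict maximality. -/
theorem exists_maximal_abelian (τ : 𝔰 ≃ₗ⁅ℝ⁆ 𝔰) :
    ∃ 𝔞 : Submodule ℝ 𝔰, (∀ x ∈ 𝔞, τ x = -x) ∧ (∀ x ∈ 𝔞, ∀ y ∈ 𝔞, ⁅x, y⁆ = 0) ∧
      ∀ z, τ z = -z → (∀ x ∈ 𝔞, ⁅x, z⁆ = 0) → z ∈ 𝔞 := by
  set P : Set (Submodule ℝ 𝔰) := {𝔞 | (∀ x ∈ 𝔞, τ x = -x) ∧ ∀ x ∈ 𝔞, ∀ y ∈ 𝔞, ⁅x, y⁆ = 0} with hP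
  have hne : P.Nonempty := ⟨⊥, by simp [hP]⟩
  obtain ⟨𝔞, h𝔞, hmax⟩ := (wellFounded_gt (α := Submodule ℝ 𝔰)).has_min P hne
  refine ⟨𝔞, h𝔞.1, h𝔞.2, fun z hz hcomm => ?_⟩
  by_contra hmem
  have hP' : 𝔞 ⊔ Submodule.span ℝ {z} ∈ P := by
    constructor
    · intro x hx
      obtain ⟨a, ha, w, hw, rfl⟩ := Submodule.mem_sup.1 hx
      obtain ⟨c, rfl⟩ := Submodule.mem_span_singleton.1 hw
      rw [map_add, map_smul, h𝔞.1 a ha, hz, smul_neg, neg_add]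
    · intro x hx y hy
      obtain ⟨a, ha, w, hw, rfl⟩ := Submodule.mem_sup.1 hx
      obtain ⟨c, rfl⟩ := Submodule.mem_span_singleton.1 hw
      obtain ⟨a', ha', w', hw', rfl⟩ := Submodule.mem_sup.1 hy
      obtain ⟨c', rfl⟩ := Submodule.mem_span_singleton.1 hw'
      have h1 : ⁅z, a'⁆ = 0 := by rw [← lie_skew, hcomm a' ha', neg_zero]
      simp [h𝔞.2 a ha a' ha', hcomm a ha, h1]
  refine hmax _ hP' (lt_of_le_of_ne le_sup_left fun h => hmem ?_)
  rw [h]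
  exact Submodule.mem_sup_right (Submodule.mem_span_singleton_self z)

/-- A real Lie algebra with a Cartan involution `τ` has an element `H` with the following
properties: `ad H` is diagonalizable, and each eigenvector `Y` of `ad H` that commutes with the
eigenvectors of positive eigenvalue satisfies `[𝔰, Y] ⊆ [𝔨, Y] + ℝ Y`, where `𝔨` is the fixed
subspace of `τ` (a consequence of the Iwasawa decomposition). -/
theorem exists_regular_hyperbolic_element (τ : 𝔰 ≃ₗ⁅ℝ⁆ 𝔰) (hτ : ∀ x, τ (τ x) = x)
    (hneg : ∀ x : 𝔰, x ≠ 0 → killingForm ℝ 𝔰 x (τ x) < 0) :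
    ∃ (n : ℕ) (b : Module.Basis (Fin n) ℝ 𝔰) (h : Fin n → ℝ) (H : 𝔰),
      (∀ i, ⁅H, b i⁆ = h i • b i) ∧
      ∀ (Y : 𝔰) (l : ℝ), ⁅H, Y⁆ = l • Y →
        (∀ (N : 𝔰) (a : ℝ), 0 < a → ⁅H, N⁆ = a • N → ⁅N, Y⁆ = 0) →
        ∀ Z : 𝔰, ∃ (k : 𝔰) (c : ℝ), τ k = k ∧ ⁅Z, Y⁆ = ⁅k, Y⁆ + c • Y := by
  obtain ⟨𝔞, h𝔞τ, h𝔞c, h𝔞max⟩ := exists_maximal_abelian τ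
  have hkτ (x y : 𝔰) : killingForm ℝ 𝔰 (τ x) (τ y) = killingForm ℝ 𝔰 x y :=
    LieAlgebra.killingForm_of_equiv_apply τ x y
  have hksymm (x y : 𝔰) : killingForm ℝ 𝔰 x y = killingForm ℝ 𝔰 y x :=
    LieModule.traceForm_comm ℝ 𝔰 𝔰 x y
  obtain ⟨n, b, hb⟩ := exists_basis_joint_eigenvectors
    -- For this positive definite form, `ad A` is symmetric when τ A = -A: invariance of the Killing
    -- form and the action of τ each contribute one sign.
    (-((killingForm ℝ 𝔰).compl₂ (τ : 𝔰 →ₗ[ℝ] 𝔰)))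
    (fun x y => by
      have : killingForm ℝ 𝔰 x (τ y) = killingForm ℝ 𝔰 y (τ x) := by
        rw [← hkτ x, hτ, hksymm]
      simpa using this)
    (fun x hx => by simpa using hneg x hx)
    (fun A : 𝔞 => (LieAlgebra.ad ℝ 𝔰 A : 𝔰 →ₗ[ℝ] 𝔰))
    (fun A x y => by
      have h1 : killingForm ℝ 𝔰 ⁅(A : 𝔰), x⁆ (τ y) = - killingForm ℝ 𝔰 x ⁅(A : 𝔰), τ y⁆ := by
        rw [← lie_skew, map_neg, LinearMap.neg_apply]
        congr 1
        exact LieModule.traceForm_apply_lie_apply ℝ 𝔰 𝔰 x A (τ y)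
      have h2 : τ ⁅(A : 𝔰), y⁆ = -⁅(A : 𝔰), τ y⁆ := by
        rw [LieEquiv.map_lie, h𝔞τ A A.2, neg_lie]
      simp only [LinearMap.neg_apply, LinearMap.compl₂_apply, LieAlgebra.ad_apply, LinearEquiv.coe_coe,
        LieEquiv.coe_toLinearEquiv, h1, h2, map_neg])
    (fun A A' => by
      ext x
      have h0 := h𝔞c A A.2 A' A'.2
      have h1 := leibniz_lie (A : 𝔰) (A' : 𝔰) x
      rw [h0, zero_lie, zero_add] at h1
      simpa using h1)
  -- the restricted weights
  set α : Fin n → Module.Dual ℝ 𝔰 := fun i => (b.coord i).comp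
    ((LieAlgebra.ad ℝ 𝔰 : 𝔰 →ₗ[ℝ] Module.End ℝ 𝔰).flip (b i)) with hα
  have hαb (i : Fin n) (A : 𝔰) (hA : A ∈ 𝔞) : ⁅A, b i⁆ = α i A • b i := by
    obtain ⟨c, hc⟩ := hb i ⟨A, hA⟩
    have hc' : ⁅A, b i⁆ = c • b i := hc
    have : α i A = c := by
      simp [hα, hc']
    rw [this, hc']
  -- a generic element of `𝔞`
  let J := {p : Fin n × Fin n // ∃ A ∈ 𝔞, (α p.1 - α p.2) A ≠ 0}
  let J' := {i : Fin n // ∃ A ∈ 𝔞, α i A ≠ 0}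
  obtain ⟨H, hH𝔞, hH⟩ := Module.Dual.exists_forall_mem_ne_zero_of_forall_exists 𝔞
    (fun j : J ⊕ J' => Sum.elim (fun p : J => α p.1.1 - α p.1.2) (fun i : J' => α i.1) j)
    (by
      rintro (p | i)
      · exact p.2
      · exact i.2)
  have hgen (i j : Fin n) (hij : α i H = α j H) (A : 𝔰) (hA : A ∈ 𝔞) : α i A = α j A := by
    by_contra hne
    refine hH (Sum.inl ⟨(i, j), A, hA, ?_⟩) ?_
    · simpa [sub_eq_zero] using hne
    · simp [hij]
  have hgen0 (i : Fin n) (hi : α i H = 0) (A : 𝔰) (hA : A ∈ 𝔞) : α i A = 0 := by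
    by_contra hne
    exact hH (Sum.inr ⟨i, A, hA, hne⟩) hi
  refine ⟨n, b, fun i => α i H, H, fun i => hαb i H hH𝔞, fun Y l hY hN Z => ?_⟩
  -- By genericity of `H`, weights that agree at `H` agree on 𝔞, so an eigenvector of `ad H` is a
  -- joint eigenvector of 𝔞.
  have heig (A : 𝔰) (hA : A ∈ 𝔞) : ∃ c : ℝ, ⁅A, Y⁆ = c • Y := by
    have hsum (A : 𝔰) (hA : A ∈ 𝔞) : ⁅A, Y⁆ = ∑ i, (b.repr Y i * α i A) • b i := by
      conv_lhs => rw [← b.sum_repr Y]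
      rw [lie_sum]
      refine Finset.sum_congr rfl fun i _ => ?_
      rw [lie_smul, hαb i A hA, smul_smul]
    have hcoord (i : Fin n) : b.repr Y i * α i H = l * b.repr Y i := by
      have h1 := congrArg (fun v => b.repr v i) (hsum H hH𝔞)
      simp only [hY, map_smul, Finsupp.smul_apply, smul_eq_mul] at h1
      rw [b.repr_sum_self] at h1
      exact h1.symm
    by_cases hY0 : Y = 0
    · exact ⟨0, by simp [hY0]⟩
    obtain ⟨i₀, hi₀⟩ : ∃ i, b.repr Y i ≠ 0 := by
      by_contra hall
      push Not at hall
      exact hY0 (b.repr.map_eq_zero_iff.1 (Finsupp.ext hall))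
    refine ⟨α i₀ A, ?_⟩
    conv_rhs => rw [← b.sum_repr Y, Finset.smul_sum]
    rw [hsum A hA]
    refine Finset.sum_congr rfl fun i _ => ?_
    rw [smul_smul]
    by_cases hi : b.repr Y i = 0
    · simp [hi]
    · have e1 : α i H = l := mul_left_cancel₀ hi ((hcoord i).trans (mul_comm _ _))
      have e2 : α i₀ H = l := mul_left_cancel₀ hi₀ ((hcoord i₀).trans (mul_comm _ _))
      rw [hgen i i₀ (e1.trans e2.symm) A hA, mul_comm]
  have hbasis (i : Fin n) : ∃ (k : 𝔰) (c : ℝ), τ k = k ∧ ⁅b i, Y⁆ = ⁅k, Y⁆ + c • Y := by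
    have hi := hαb i H hH𝔞
    have hτi (A : 𝔰) (hA : A ∈ 𝔞) : ⁅A, τ (b i)⁆ = (-α i A) • τ (b i) := by
      have h1 : τ ⁅A, b i⁆ = α i A • τ (b i) := by rw [hαb i A hA, map_smul]
      rw [LieEquiv.map_lie, h𝔞τ A hA, neg_lie] at h1
      rw [neg_smul, ← h1, neg_neg]
    rcases lt_trichotomy (α i H) 0 with hlt | heq | hgt
    -- Negative weight: τ reverses weights, so τ (b i) has positive weight and kills `Y`; adding it
    -- to `b i` gives a fixed vector with the same bracket.
    · refine ⟨b i + τ (b i), 0, by rw [map_add, hτ, add_comm], ?_⟩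
      rw [add_lie, hN (τ (b i)) (-α i H) (by linarith) (hτi H hH𝔞)]
      simp
    -- Weight zero: `b i` centralizes 𝔞, so its anti-fixed part lies in 𝔞 by maximality and acts on
    -- `Y` by a scalar.
    · have hmem : (2⁻¹ : ℝ) • (b i - τ (b i)) ∈ 𝔞 := by
        refine h𝔞max _ ?_ fun A hA => ?_
        · rw [map_smul, map_sub, hτ, ← smul_neg, neg_sub]
        · rw [lie_smul, lie_sub, hαb i A hA, hτi A hA, hgen0 i heq A hA]
          simp
      obtain ⟨c, hc⟩ := heig _ hmem
      refine ⟨(2⁻¹ : ℝ) • (b i + τ (b i)), c, by rw [map_smul, map_add, hτ, add_comm], ?_⟩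
      rw [← hc, ← add_lie, ← smul_add]
      congr 1
      rw [add_add_sub_cancel, ← two_smul ℝ, smul_smul]
      norm_num
    · exact ⟨0, 0, map_zero τ, by rw [hN _ _ hgt hi]; simp⟩
  choose k c hk hkc using hbasis
  refine ⟨∑ i, b.repr Z i • k i, ∑ i, b.repr Z i * c i, ?_, ?_⟩
  · simp [hk]
  · conv_lhs => rw [← b.sum_repr Z]
    rw [sum_lie, sum_lie, Finset.sum_smul, ← Finset.sum_add_distrib]
    refine Finset.sum_congr rfl fun i _ => ?_
    rw [smul_lie, hkc, smul_add, smul_lie, smul_smul]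

end CartanInvolution

/-! ### Nilpotent elements are rescaled by the adjoint action. -/

section NilpotentElements

variable {L : Type*} [LieRing L] [LieAlgebra ℂ L] [FiniteDimensional ℂ L]

/-- An ad-nilpotent element `X` of a semisimple Lie algebra satisfies `[H, X] = X` for some `H`. -/
theorem exists_lie_eq_self_of_isNilpotent_ad [LieAlgebra.IsKilling ℂ L] {X : L}
    (hX : IsNilpotent (LieAlgebra.ad ℂ L X)) : ∃ H : L, ⁅H, X⁆ = X := by
  by_contra hne
  push Not at hne
  have hmem : X ∉ LinearMap.range (LieAlgebra.ad ℂ L X : L →ₗ[ℂ] L) := by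
    rintro ⟨W, hW⟩
    refine hne (-W) ?_
    rw [neg_lie, lie_skew]
    exact hW
  -- Otherwise a functional, represented by some `Z` through the Killing form, kills [X, L] but not
  -- X. Then `Z` commutes with `X`, so ad Z ∘ ad X is nilpotent and has trace 0, a contradiction.
  obtain ⟨f, hfX, hf⟩ := Submodule.exists_le_ker_of_notMem hmem
  obtain ⟨Z, rfl⟩ : ∃ Z, killingForm ℂ L Z = f :=
    ((killingForm ℂ L).toDual (LieAlgebra.IsKilling.killingForm_nondegenerate ℂ L)).surjective f
  have hcomm : ⁅Z, X⁆ = 0 := by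
    refine (LieAlgebra.IsKilling.killingForm_nondegenerate ℂ L).1 _ fun W => ?_
    have h1 : killingForm ℂ L ⁅Z, X⁆ W = killingForm ℂ L Z ⁅X, W⁆ :=
      LieModule.traceForm_apply_lie_apply ℂ L L Z X W
    rw [h1]
    exact hf ⟨W, rfl⟩
  have hc : Commute (LieAlgebra.ad ℂ L Z) (LieAlgebra.ad ℂ L X) := by
    refine LinearMap.ext fun w => ?_
    have := leibniz_lie Z X w
    rwa [hcomm, zero_lie, zero_add] at this
  have hnil : IsNilpotent (LieAlgebra.ad ℂ L Z ∘ₗ LieAlgebra.ad ℂ L X) :=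
    hc.isNilpotent_mul_left hX
  refine hfX ?_
  rw [killingForm_apply_apply]
  exact (LinearMap.isNilpotent_trace_of_isNilpotent hnil).eq_zero

end NilpotentElements

/-! ### A highest weight vector in a closed stable set of nilpotent elements. -/

section RealForms

variable {L : Type*} [LieRing L] [LieAlgebra ℂ L] [FiniteDimensional ℂ L]
  [TopologicalSpace L] [IsTopologicalAddGroup L] [ContinuousSMul ℂ L] [T2Space L]

instance : ContinuousSMul ℝ L where
  continuous_smul := by
    have : Continuous fun p : ℝ × L => (p.1 : ℂ) • p.2 :=
      (Complex.continuous_ofReal.comp continuous_fst).smul continuous_snd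
    simpa using this

instance : FiniteDimensional ℝ L := FiniteDimensional.complexToReal L

/-- Let `C` be a closed set of ad-nilpotent elements of a semisimple complex Lie algebra that is
stable under the flows of the adjoint action. If `C` contains a nonzero element of the real form
`S`, then it contains a nonzero `Y ∈ S` such that `[L, Y] ⊆ [𝔨, Y] + ℂ Y`, where `𝔨` is the fixed
subspace of the Cartan involution. -/
theorem exists_mem_realForm_lie_le_fixed_sup_span [LieAlgebra.IsKilling ℂ L]
    (τ : L →ₗ⁅ℂ⁆ L) (hτ : ∀ x, τ (τ x) = x) {S : LieSubalgebra ℝ L} (hS : IsRealForm S)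
    (hcartan : RestrictsToCartanInvolution τ S) {C : Set L} (hC : IsClosed C)
    (hnil : ∀ Y ∈ C, IsNilpotent (LieAlgebra.ad ℂ L Y))
    (hexp : ∀ (Z : L) (n : ℕ) (v : Fin n → L) (h : Fin n → ℂ), (∀ i, ⁅Z, v i⁆ = h i • v i) →
      ∑ i, v i ∈ C → ∑ i, Complex.exp (h i) • v i ∈ C)
    (hflow : ∀ Z : L, ∀ Y ∈ C, ∃ γ : ℝ → L, (∀ s, γ s ∈ C) ∧
      (∀ V : Submodule ℝ L, IsClosed (V : Set L) → (∀ w ∈ V, ⁅Z, w⁆ ∈ V) → Y ∈ V →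
        ∀ s, γ s ∈ V) ∧ Tendsto (fun s : ℝ => s⁻¹ • (γ s - Y)) (𝓝[≠] 0) (𝓝 ⁅Z, Y⁆))
    {X : L} (hXC : X ∈ C) (hXS : X ∈ S) (hX0 : X ≠ 0) :
    ∃ Y ∈ C, Y ∈ S ∧ Y ≠ 0 ∧ ∀ Z : L, ∃ (k : L) (c : ℂ), τ k = k ∧ ⁅Z, Y⁆ = ⁅k, Y⁆ + c • Y := by
  obtain ⟨hτS, hneg⟩ := hcartan
  let τS : S ≃ₗ⁅ℝ⁆ S :=
    { toFun := fun x => ⟨τ x, hτS x x.2⟩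
      invFun := fun x => ⟨τ x, hτS x x.2⟩
      map_add' := fun x y => by ext; simp
      map_smul' := fun c x => by
        ext
        change τ (c • (x : L)) = c • τ x
        rw [← Complex.coe_smul, map_smul, Complex.coe_smul]
      map_lie' := fun {x y} => by ext; simp
      left_inv := fun x => by ext; simp [hτ]
      right_inv := fun x => by ext; simp [hτ] }
  obtain ⟨n, b, h, H, hH, hgood⟩ := exists_regular_hyperbolic_element τS
    (fun x => by ext; exact hτ x) hneg
  have hHL (i : Fin n) : ⁅(H : L), (b i : L)⁆ = h i • (b i : L) := congrArg Subtype.val (hH i)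
  -- `C` is a cone: if [W, Y] = Y, then exp(t ad W) multiplies `Y` by the exponential of t.
  have hcone (Y : L) (hY : Y ∈ C) (t : ℝ) : Real.exp t • Y ∈ C := by
    obtain ⟨W, hW⟩ := exists_lie_eq_self_of_isNilpotent_ad (hnil Y hY)
    have := hexp ((t : ℂ) • W) 1 (fun _ => Y) (fun _ => t) (fun _ => by rw [smul_lie, hW])
      (by simpa using hY)
    simp only [Finset.univ_unique, Finset.sum_const, Finset.card_singleton, one_smul] at this
    rwa [← Complex.ofReal_exp, Complex.coe_smul] at this
  -- the largest eigenvalue of `ad H` that occurs in `C ∩ S`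
  obtain ⟨i₀, ⟨Y₀, hY₀C, hY₀i⟩, hmax⟩ : ∃ i₀, (∃ Y : S, (Y : L) ∈ C ∧ b.repr Y i₀ ≠ 0) ∧
      ∀ i, (∃ Y : S, (Y : L) ∈ C ∧ b.repr Y i ≠ 0) → h i ≤ h i₀ := by
    classical
    have hne : (Finset.univ.filter fun i => ∃ Y : S, (Y : L) ∈ C ∧ b.repr Y i ≠ 0).Nonempty := by
      by_contra hemp
      rw [Finset.not_nonempty_iff_eq_empty, Finset.filter_eq_empty_iff] at hemp
      refine hX0 ?_
      have : b.repr ⟨X, hXS⟩ = 0 := by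
        ext i
        by_contra hne
        exact hemp (Finset.mem_univ i) ⟨⟨X, hXS⟩, hXC, hne⟩
      exact congrArg Subtype.val (b.repr.map_eq_zero_iff.1 this)
    obtain ⟨i₀, hi₀, hm⟩ := Finset.exists_max_image _ h hne
    refine ⟨i₀, (Finset.mem_filter.1 hi₀).2, fun i hi => hm i ?_⟩
    exact Finset.mem_filter.2 ⟨Finset.mem_univ i, hi⟩
  set l := h i₀ with hl
  have hYexp (Y : S) : (Y : L) = ∑ i, b.repr Y i • (b i : L) := by
    have := congrArg (S.subtype : S →ₗ[ℝ] L) (b.sum_repr Y)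
    rw [map_sum] at this
    exact this.symm
  classical
  set Y : S := ∑ i, (if h i = l then b.repr Y₀ i else 0) • b i with hYdef
  have hYrepr (i : Fin n) : b.repr Y i = if h i = l then b.repr Y₀ i else 0 := by
    rw [hYdef, b.repr_sum_self]
  have hYL : (Y : L) = ∑ i, (if h i = l then b.repr Y₀ i else 0) • (b i : L) := by
    rw [hYexp]
    exact Finset.sum_congr rfl fun i _ => by rw [hYrepr]
  have hYC : (Y : L) ∈ C := by
    -- Flowing along `H` and rescaling by exp(-tl) keeps the component of eigenvalue `l` and damps
    -- those below it; none above it occurs.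
    have hpath (t : ℝ) :
        ∑ i, (Real.exp (t * (h i - l)) * b.repr Y₀ i) • (b i : L) ∈ C := by
      have h1 := hexp ((t : ℂ) • (H : L)) n (fun i => b.repr Y₀ i • (b i : L))
        (fun i => ((t * h i : ℝ) : ℂ)) (fun i => by
          rw [smul_lie, lie_smul, hHL, Complex.coe_smul, Complex.coe_smul]
          simp only [smul_smul]
          congr 1; ring) (by rw [← hYexp]; exact hY₀C)
      have h2 := hcone _ h1 (-(t * l))
      rw [Finset.smul_sum] at h2
      convert h2 using 2 with i
      rw [← Complex.ofReal_exp, Complex.coe_smul, smul_smul, smul_smul, ← Real.exp_add]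
      congr 3
      ring
    have hlim : Tendsto (fun t : ℝ => ∑ i, (Real.exp (t * (h i - l)) * b.repr Y₀ i) • (b i : L))
        atTop (𝓝 (Y : L)) := by
      rw [hYL]
      refine tendsto_finsetSum _ fun i _ => Tendsto.smul_const ?_ _
      by_cases hy : b.repr Y₀ i = 0
      · simp [hy]
      · have hle : h i ≤ l := hmax i ⟨Y₀, hY₀C, hy⟩
        rcases hle.eq_or_lt with heq | hlt
        · simp [heq]
        · rw [if_neg hlt.ne]
          have h3 : Tendsto (fun t : ℝ => Real.exp (t * (h i - l))) atTop (𝓝 0) :=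
            Real.tendsto_exp_atBot.comp
              (tendsto_id.atTop_mul_const_of_neg (sub_neg.2 hlt))
          simpa using h3.mul_const (b.repr Y₀ i)
    exact hC.mem_of_tendsto hlim (Eventually.of_forall hpath)
  have hHY : ⁅H, Y⁆ = l • Y := by
    rw [hYdef, lie_sum, Finset.smul_sum]
    refine Finset.sum_congr rfl fun i _ => ?_
    rw [lie_smul, hH, smul_smul, smul_smul]
    by_cases hi : h i = l
    · rw [hi, mul_comm]
    · simp [hi]
  have hNY (N : S) (a : ℝ) (ha : 0 < a) (hN : ⁅H, N⁆ = a • N) : ⁅N, Y⁆ = 0 := by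
    obtain ⟨γ, hγC, hγV, hγ⟩ := hflow N Y hYC
    have hclosed (V : Submodule ℝ L) : IsClosed (V : Set L) := V.closed_of_finiteDimensional
    have hγS (s : ℝ) : γ s ∈ S :=
      hγV S.toSubmodule (hclosed _) (fun w hw => S.lie_mem N.2 hw) Y.2 s
    -- Vectors without components of eigenvalue above `l`. By maximality, `P` contains every point
    -- of `C` in `S`, hence also the velocity [N, Y] of the flow of `N` at `Y`; but [N, Y] has
    -- eigenvalue a + l > l.
    set P : Submodule ℝ S := ⨅ i : {i // l < h i}, LinearMap.ker (b.coord i) with hP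
    have hmemP (y : S) (hy : (y : L) ∈ C) : y ∈ P := by
      refine (Submodule.mem_iInf _).2 fun i => LinearMap.mem_ker.2 ?_
      by_contra hne
      exact (hmax i ⟨y, hy, hne⟩).not_gt i.2
    set V : Submodule ℝ L := P.map (S.subtype : S →ₗ[ℝ] L) with hV
    have hmemV (s : ℝ) : s⁻¹ • (γ s - Y) ∈ V :=
      V.smul_mem _ (V.sub_mem ⟨⟨γ s, hγS s⟩, hmemP _ (hγC s), rfl⟩ ⟨Y, hmemP _ hYC, rfl⟩)
    have hlimV : ⁅(N : L), (Y : L)⁆ ∈ V :=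
      (hclosed V).mem_of_tendsto hγ (Eventually.of_forall hmemV)
    obtain ⟨w, hwP, hw⟩ := hlimV
    have hw' : w = ⁅N, Y⁆ := Subtype.ext hw
    rw [hw'] at hwP
    have hHW : ⁅H, ⁅N, Y⁆⁆ = (a + l) • ⁅N, Y⁆ := by
      rw [leibniz_lie, hN, hHY, smul_lie, lie_smul, add_smul]
    refine b.repr.map_eq_zero_iff.1 (Finsupp.ext fun i => ?_)
    by_cases hi : l < h i
    · exact LinearMap.mem_ker.1 ((Submodule.mem_iInf _).1 hwP ⟨i, hi⟩)
    · have h1 : b.repr ⁅H, ⁅N, Y⁆⁆ i = h i * b.repr ⁅N, Y⁆ i := by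
        have h2 : ⁅H, ⁅N, Y⁆⁆ = ∑ j, (b.repr ⁅N, Y⁆ j * h j) • b j := by
          conv_lhs => rw [← b.sum_repr ⁅N, Y⁆]
          rw [lie_sum]
          exact Finset.sum_congr rfl fun j _ => by rw [lie_smul, hH, smul_smul]
        rw [h2, b.repr_sum_self, mul_comm]
      rw [hHW, map_smul, Finsupp.smul_apply, smul_eq_mul] at h1
      have h3 : (a + l - h i) * b.repr ⁅N, Y⁆ i = 0 := by linarith
      rcases mul_eq_zero.1 h3 with h4 | h4
      · linarith
      · exact h4
  refine ⟨Y, hYC, Y.2, fun h0 => hY₀i ?_, fun Z => ?_⟩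
  · have h1 : Y = 0 := Subtype.ext h0
    have h2 := hYrepr i₀
    rw [h1, if_pos hl.symm] at h2
    simpa using h2.symm
  · obtain ⟨⟨Z₁, Z₂⟩, hZ, -⟩ := hS Z
    obtain ⟨k₁, c₁, hk₁, h₁⟩ := hgood Y l hHY hNY Z₁
    obtain ⟨k₂, c₂, hk₂, h₂⟩ := hgood Y l hHY hNY Z₂
    have h₁' : ⁅(Z₁ : L), (Y : L)⁆ = ⁅(k₁ : L), (Y : L)⁆ + c₁ • (Y : L) := congrArg Subtype.val h₁
    have h₂' : ⁅(Z₂ : L), (Y : L)⁆ = ⁅(k₂ : L), (Y : L)⁆ + c₂ • (Y : L) := congrArg Subtype.val h₂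
    have hk₁' : τ (k₁ : L) = k₁ := congrArg Subtype.val hk₁
    have hk₂' : τ (k₂ : L) = k₂ := congrArg Subtype.val hk₂
    refine ⟨k₁ + Complex.I • k₂, c₁ + Complex.I * c₂, by rw [map_add, map_smul, hk₁', hk₂'], ?_⟩
    simp only at hZ
    rw [hZ, add_lie, add_lie, smul_lie, smul_lie, h₁', h₂', smul_add, add_smul, mul_smul,
      Complex.coe_smul, Complex.coe_smul]
    abel

end RealForms

/-! ### Coisotropy from a rank condition on the Kirillov form. -/

section KKS

variable {L : Type*} [LieRing L] [LieAlgebra ℂ L] [FiniteDimensional ℂ L]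

theorem kksForm_self (ν : Module.Dual ℂ L) (v : L ⧸ coadjointStabilizer ν) :
    kksForm ν v v = 0 := by
  obtain ⟨X, rfl⟩ := Submodule.mkQ_surjective _ v
  change ν ⁅X, X⁆ = 0
  rw [lie_self, map_zero]

theorem kksForm_injective (ν : Module.Dual ℂ L) : Function.Injective (kksForm ν) := by
  rw [injective_iff_map_eq_zero]
  intro v hv
  obtain ⟨X, rfl⟩ := Submodule.mkQ_surjective _ v
  refine (Submodule.Quotient.mk_eq_zero _).2 (LinearMap.mem_ker.2 (LinearMap.ext fun Y => ?_))
  exact LinearMap.congr_fun hv (Submodule.mkQ _ Y)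

theorem kksForm_surjective (ν : Module.Dual ℂ L) : Function.Surjective (kksForm ν) :=
  (LinearMap.injective_iff_surjective_of_finrank_eq_finrank
    (Subspace.dual_finrank_eq).symm).1 (kksForm_injective ν)

/-- A family of vectors of `𝔨` on which a minor of the Kirillov form does not vanish is linearly
independent modulo the stabilizer; if the size of the minor is at least the dimension of the
orbit minus one, the image of `𝔨` is coisotropic. -/
theorem isCoisotropicSubspace_of_det_ne_zero {ν : Module.Dual ℂ L} {𝔨 : Submodule ℂ L} {r : ℕ}
    (hr : Module.finrank ℂ (L ⧸ coadjointStabilizer ν) ≤ r + 1) {k Y : Fin r → L}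
    (hk : ∀ i, k i ∈ 𝔨) (hdet : (Matrix.of fun i j => ν ⁅k i, Y j⁆).det ≠ 0) :
    IsCoisotropicSubspace (kksForm ν) (𝔨.map (coadjointStabilizer ν).mkQ) := by
  set W := 𝔨.map (coadjointStabilizer ν).mkQ with hW
  have hli : LinearIndependent ℂ fun i =>
      (⟨(coadjointStabilizer ν).mkQ (k i), Submodule.mem_map_of_mem (hk i)⟩ : W) := by
    rw [Fintype.linearIndependent_iff]
    intro c hc
    have h1 : (coadjointStabilizer ν).mkQ (∑ i, c i • k i) = 0 := by
      have := congrArg W.subtype hc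
      simpa using this
    have h2 : ∑ i, c i • k i ∈ coadjointStabilizer ν := by
      rwa [Submodule.mkQ_apply, Submodule.Quotient.mk_eq_zero] at h1
    have h3 : Matrix.vecMul c (Matrix.of fun i j => ν ⁅k i, Y j⁆) = 0 := by
      ext j
      have h4 : ν ⁅∑ i, c i • k i, Y j⁆ = 0 := LinearMap.congr_fun (LinearMap.mem_ker.1 h2) (Y j)
      rw [sum_lie, map_sum] at h4
      simpa [Matrix.vecMul, dotProduct] using h4
    exact congrFun (Matrix.eq_zero_of_vecMul_eq_zero hdet h3)
  have hWr : r ≤ Module.finrank ℂ W := by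
    simpa using hli.fintype_card_le_finrank
  intro v hv
  by_contra hvW
  have hlt : W < W ⊔ Submodule.span ℂ {v} :=
    lt_of_le_of_ne le_sup_left fun h => hvW (by
      rw [h]; exact Submodule.mem_sup_right (Submodule.mem_span_singleton_self v))
  -- `W` has codimension at most one, so a `v` outside it completes it. If `v` is orthogonal to `W`,
  -- it is then orthogonal to everything, since the form is alternating, and nondegeneracy gives v =
  -- 0.
  have htop : W ⊔ Submodule.span ℂ {v} = ⊤ := by
    refine Submodule.eq_top_of_finrank_eq (le_antisymm (Submodule.finrank_le _) ?_)
    have := Submodule.finrank_lt_finrank_of_lt hlt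
    omega
  have hzero : kksForm ν v = 0 := by
    refine LinearMap.ext fun u => ?_
    have hu : u ∈ W ⊔ Submodule.span ℂ {v} := htop ▸ Submodule.mem_top
    obtain ⟨w, hw, t, ht, rfl⟩ := Submodule.mem_sup.1 hu
    obtain ⟨c, rfl⟩ := Submodule.mem_span_singleton.1 ht
    rw [map_add, hv w hw, map_smul, kksForm_self]
    simp
  exact hvW (kksForm_injective ν (hzero.trans (map_zero _).symm) ▸ zero_mem _)

/-- If `𝔨` spans `L` together with the stabilizer of `ν` and one more vector, then a minor of the
Kirillov form, of size the dimension of the orbit minus one, does not vanish on `𝔨`. -/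
theorem exists_det_ne_zero {ν : Module.Dual ℂ L} {𝔨 : Submodule ℂ L} {Q : L}
    (hQ : ∀ Z : L, ∃ k ∈ 𝔨, ∃ c : ℂ, Z - (k + c • Q) ∈ coadjointStabilizer ν) {r : ℕ}
    (hr : r = Module.finrank ℂ (L ⧸ coadjointStabilizer ν) - 1) :
    ∃ k Y : Fin r → L, (∀ i, k i ∈ 𝔨) ∧ (Matrix.of fun i j => ν ⁅k i, Y j⁆).det ≠ 0 := by
  set π := (coadjointStabilizer ν).mkQ with hπ
  set W := 𝔨.map π with hW
  have htop : W ⊔ Submodule.span ℂ {π Q} = ⊤ := by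
    rw [eq_top_iff]
    intro v _
    obtain ⟨Z, rfl⟩ := Submodule.mkQ_surjective _ v
    obtain ⟨k, hk, c, hc⟩ := hQ Z
    have : π Z = π k + c • π Q := by
      rw [← map_smul, ← map_add, ← sub_eq_zero, ← map_sub]
      exact (Submodule.Quotient.mk_eq_zero _).2 hc
    change π Z ∈ _
    rw [this]
    exact Submodule.add_mem_sup (Submodule.mem_map_of_mem hk)
      (Submodule.smul_mem _ _ (Submodule.mem_span_singleton_self _))
  have hrW : r ≤ Module.finrank ℂ W := by
    have h1 := Submodule.finrank_add_le_finrank_add_finrank W (Submodule.span ℂ {π Q})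
    rw [htop, finrank_top] at h1
    have h2 := (finrank_span_le_card (R := ℂ) ({π Q} : Set (L ⧸ coadjointStabilizer ν))).trans_eq
      (Set.toFinset_card _ |>.trans (by simp) : _ = 1)
    omega
  set b := Module.finBasis ℂ W
  set w : Fin r → W := fun i => b (Fin.castLE hrW i) with hw
  have hwli : LinearIndependent ℂ fun i => (w i : L ⧸ coadjointStabilizer ν) :=
    (b.linearIndependent.comp _ (Fin.castLE_injective hrW)).map' W.subtype
      (Submodule.ker_subtype W)
  have hk (i : Fin r) : ∃ k ∈ 𝔨, π k = w i := Submodule.mem_map.1 (w i).2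
  choose k hk𝔨 hkw using hk
  -- Nondegeneracy represents the functionals dual to the `w i`, so the minor becomes the identity
  -- matrix. The sign of `-Y` accounts for the order in the bracket.
  have hY (j : Fin r) : ∃ Y : L, ∀ i, ν ⁅k i, Y⁆ = if i = j then 1 else 0 := by
    obtain ⟨f, hf⟩ := LinearMap.exists_extend ((Finsupp.lapply j).comp hwli.repr : _ →ₗ[ℂ] ℂ)
    obtain ⟨y, hy⟩ := kksForm_surjective ν f
    obtain ⟨Y, rfl⟩ := Submodule.mkQ_surjective _ y
    refine ⟨-Y, fun i => ?_⟩
    have h1 : kksForm ν (π Y) (π (k i)) = ν ⁅Y, k i⁆ := rfl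
    have h2 : f (w i) = if i = j then 1 else 0 := by
      have h3 := LinearMap.congr_fun hf ⟨w i, Submodule.subset_span ⟨i, rfl⟩⟩
      refine h3.trans ?_
      change hwli.repr ⟨w i, _⟩ j = _
      rw [hwli.repr_eq_single i _ rfl, Finsupp.single_apply]
    rw [lie_neg, lie_skew, ← h1, hkw, ← h2, ← hy]
  choose Y hY using hY
  refine ⟨k, Y, hk𝔨, ?_⟩
  have : (Matrix.of fun i j => ν ⁅k i, Y j⁆) = 1 := by
    ext i j
    simp [hY, Matrix.one_apply]
  rw [this, Matrix.det_one]
  exact one_ne_zero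

end KKS

/-! ### One-parameter groups exp(s ad Z) acting on closed stable sets. -/

section AdjointFlow

variable {E : Type*} [NormedAddCommGroup E] [NormedSpace ℂ E]
  {G : Type*} [TopologicalSpace G] [ChartedSpace E G] [Group G]
variable [CompleteSpace E] [LieGroup 𝓘(ℂ, E) ω G]

theorem exp_apply_mem_of_isClosed {T : E →L[ℂ] E} {V : Submodule ℝ E}
    (hV : IsClosed (V : Set E)) (hT : ∀ w ∈ V, T w ∈ V) {Y : E} (hY : Y ∈ V) (s : ℝ) :
    NormedSpace.exp ((s : ℂ) • T) Y ∈ V := by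
  have h1 := (NormedSpace.exp_series_hasSum_exp' (𝕂 := ℂ) ((s : ℂ) • T)).mapL
    (ContinuousLinearMap.apply ℂ E Y)
  have h2 : ∀ n : ℕ, (T ^ n) Y ∈ V := by
    intro n
    induction n with
    | zero => simpa using hY
    | succ n ih =>
      rw [pow_succ', mul_apply_eq_comp]
      exact hT _ ih
  refine hV.mem_of_tendsto h1 (Eventually.of_forall fun t => V.sum_mem fun n _ => ?_)
  have h3 : ContinuousLinearMap.apply ℂ E Y ((n.factorial⁻¹ : ℂ) • ((s : ℂ) • T) ^ n) =
      ((n.factorial : ℝ)⁻¹ * s ^ n) • (T ^ n) Y := by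
    rw [smul_pow, smul_smul, ← Complex.coe_smul]
    simp
  rw [h3]
  exact V.smul_mem _ (h2 n)

theorem tendsto_slope_exp_apply (T : E →L[ℂ] E) (Y : E) :
    Tendsto (fun s : ℝ => s⁻¹ • (NormedSpace.exp ((s : ℂ) • T) Y - Y)) (𝓝[≠] 0) (𝓝 (T Y)) := by
  have h1 := (hasDerivAt_exp_smul_const (𝕂 := ℂ) T (0 : ℂ)).clm_apply (hasDerivAt_const (0 : ℂ) Y)
  have hlim : Tendsto (fun s : ℝ => (s : ℂ)) (𝓝[≠] 0) (𝓝[≠] 0) := by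
    rw [tendsto_nhdsWithin_iff]
    refine ⟨(Complex.continuous_ofReal.tendsto' 0 0 Complex.ofReal_zero).mono_left
      nhdsWithin_le_nhds, ?_⟩
    filter_upwards [self_mem_nhdsWithin] with s hs
    simpa using hs
  have h2 := h1.tendsto_slope_zero.comp hlim
  simp only [zero_smul, NormedSpace.exp_zero, one_mul, zero_add, map_zero, add_zero] at h2
  refine h2.congr fun s => ?_
  rw [← Complex.coe_smul, Complex.ofReal_inv]
  rfl

/-- Stability under exp(ad Z) evaluated on sums of eigenvectors, a form that mentions only brackets
and complex exponentials and so feeds the purely Lie-algebraic argument. -/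
theorem exp_ad_sum_mem {C : Set (GroupLieAlgebra 𝓘(ℂ, E) G)} (hC : IsClosed C)
    (hG : ∀ (g : G), ∀ Y ∈ C, adjointAction g Y ∈ C) (Z : GroupLieAlgebra 𝓘(ℂ, E) G) (n : ℕ)
    (v : Fin n → GroupLieAlgebra 𝓘(ℂ, E) G) (h : Fin n → ℂ)
    (hv : ∀ i, ⁅Z, v i⁆ = h i • v i) (hmem : ∑ i, v i ∈ C) :
    ∑ i, Complex.exp (h i) • v i ∈ C := by
  obtain ⟨T, hT, hTC⟩ := exp_ad_mem_of_isClosed (E := E) (G := G) hC hG Z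
  have h1 := hTC _ hmem
  have h2 (v : Fin n → E) (hv : ∀ i, T (v i) = h i • v i) :
      NormedSpace.exp T (∑ i, v i) = ∑ i, Complex.exp (h i) • v i := by
    rw [map_sum]
    exact Finset.sum_congr rfl fun i _ => exp_apply_of_apply_eq_smul (hv i)
  have h3 := h2 v fun i => (hT (v i)).trans (hv i)
  exact Eq.mp (congrArg (fun y : E => y ∈ (C : Set E)) h3) h1

/-- The curve is s ↦ exp(s ad Z) Y. Its invariance of closed real subspaces, seen on the exponential
series, is what keeps it inside the real form when `Z` is in it. -/
theorem exists_ad_flow {C : Set (GroupLieAlgebra 𝓘(ℂ, E) G)} (hC : IsClosed C)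
    (hG : ∀ (g : G), ∀ Y ∈ C, adjointAction g Y ∈ C) (Z Y : GroupLieAlgebra 𝓘(ℂ, E) G)
    (hY : Y ∈ C) :
    ∃ γ : ℝ → GroupLieAlgebra 𝓘(ℂ, E) G, (∀ s, γ s ∈ C) ∧
      (∀ V : Submodule ℝ (GroupLieAlgebra 𝓘(ℂ, E) G),
        IsClosed (V : Set (GroupLieAlgebra 𝓘(ℂ, E) G)) → (∀ w ∈ V, ⁅Z, w⁆ ∈ V) → Y ∈ V →
        ∀ s, γ s ∈ V) ∧ Tendsto (fun s : ℝ => s⁻¹ • (γ s - Y)) (𝓝[≠] 0) (𝓝 ⁅Z, Y⁆) := by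
  obtain ⟨T, hT, -⟩ := exp_ad_mem_of_isClosed (E := E) (G := G) hC hG Z
  refine ⟨fun s => NormedSpace.exp ((s : ℂ) • T) Y, fun s => ?_, fun V hV hZ hYV s => ?_, ?_⟩
  · obtain ⟨T', hT', hTC'⟩ := exp_ad_mem_of_isClosed (E := E) (G := G) hC hG ((s : ℂ) • Z)
    have : T' = (s : ℂ) • T := by
      refine ContinuousLinearMap.ext fun w => ?_
      rw [hT', smul_apply, hT]
      exact smul_lie (L := GroupLieAlgebra 𝓘(ℂ, E) G) (M := GroupLieAlgebra 𝓘(ℂ, E) G) (s : ℂ) Z w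
    have h1 := hTC' Y hY
    rw [this] at h1
    exact h1
  · exact exp_apply_mem_of_isClosed (E := E) (T := T) (V := V) hV
      (fun w hw => by rw [hT]; exact hZ w hw) hYV s
  · have h1 (y : E) : Tendsto (fun s : ℝ => s⁻¹ • (NormedSpace.exp ((s : ℂ) • T) y - y)) (𝓝[≠] 0)
        (𝓝 (lieOne G Z y)) := hT y ▸ tendsto_slope_exp_apply T y
    exact h1 Y

end AdjointFlow

/-! ### From one good point to an open dense part of the coadjoint orbit. -/

section Assembly

variable {E : Type*} [NormedAddCommGroup E] [NormedSpace ℂ E] [FiniteDimensional ℂ E]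
  [CompleteSpace E]
  {G : Type*} [TopologicalSpace G] [ChartedSpace E G] [Group G] [LieGroup 𝓘(ℂ, E) ω G]

instance : FiniteDimensional ℂ (GroupLieAlgebra 𝓘(ℂ, E) G) :=
  inferInstanceAs (FiniteDimensional ℂ E)

instance : T2Space (GroupLieAlgebra 𝓘(ℂ, E) G) := inferInstanceAs (T2Space E)

/-- By Cayley–Hamilton the dimension is a uniform nilpotency exponent, so the cone is the zero set
of one continuous map. -/
theorem isClosed_nilpotentCone : IsClosed (nilpotentCone (GroupLieAlgebra 𝓘(ℂ, E) G)) := by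
  set N := Module.finrank ℂ (GroupLieAlgebra 𝓘(ℂ, E) G) with hN
  have h1 (Y : GroupLieAlgebra 𝓘(ℂ, E) G) : Y ∈ nilpotentCone (GroupLieAlgebra 𝓘(ℂ, E) G) ↔
      LieAlgebra.ad ℂ (GroupLieAlgebra 𝓘(ℂ, E) G) Y ^ N = 0 := by
    refine ⟨fun h => ?_, fun h => ⟨N, h⟩⟩
    have h2 := LinearMap.aeval_self_charpoly (LieAlgebra.ad ℂ (GroupLieAlgebra 𝓘(ℂ, E) G) Y)
    rw [(LinearMap.isNilpotent_iff_charpoly _).1 h] at h2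
    simpa using h2
  let A : E →ₗ[ℂ] (E →L[ℂ] E) :=
    { toFun := fun Y => LinearMap.toContinuousLinearMap (E := E) (F' := E)
        (LieAlgebra.ad ℂ (GroupLieAlgebra 𝓘(ℂ, E) G) Y)
      map_add' := fun X Y => by
        refine ContinuousLinearMap.ext fun w => ?_
        exact add_lie (L := GroupLieAlgebra 𝓘(ℂ, E) G) (M := GroupLieAlgebra 𝓘(ℂ, E) G) X Y w
      map_smul' := fun c X => by
        refine ContinuousLinearMap.ext fun w => ?_
        exact smul_lie (L := GroupLieAlgebra 𝓘(ℂ, E) G) (M := GroupLieAlgebra 𝓘(ℂ, E) G) c X w }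
  have hA : Continuous A := A.continuous_of_finiteDimensional
  have h2 (Y : E) (n : ℕ) (w : E) : (A Y ^ n) w =
      (LieAlgebra.ad ℂ (GroupLieAlgebra 𝓘(ℂ, E) G) Y ^ n) w := by
    induction n generalizing w with
    | zero => rfl
    | succ n ih =>
      rw [pow_succ, pow_succ, mul_apply_eq_comp, ih]
      rfl
  have h3 : nilpotentCone (GroupLieAlgebra 𝓘(ℂ, E) G) = {Y : E | A Y ^ N = 0} := by
    ext Y
    rw [h1]
    constructor
    · intro h
      refine ContinuousLinearMap.ext fun w => ?_
      refine (h2 Y N w).trans ?_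
      rw [h]
      rfl
    · intro h
      refine LinearMap.ext fun w => ?_
      refine (h2 Y N w).symm.trans ?_
      rw [show A Y ^ N = 0 from h]
      rfl
  rw [h3]
  exact isClosed_eq (hA.pow N) continuous_const

theorem adjointAction_mem_nilpotentCone (g : G) {Y : GroupLieAlgebra 𝓘(ℂ, E) G}
    (hY : Y ∈ nilpotentCone (GroupLieAlgebra 𝓘(ℂ, E) G)) :
    adjointAction g Y ∈ nilpotentCone (GroupLieAlgebra 𝓘(ℂ, E) G) := by
  obtain ⟨n, hn⟩ := hY
  refine ⟨n, LinearMap.ext fun w => ?_⟩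
  have h (m : ℕ) (w : GroupLieAlgebra 𝓘(ℂ, E) G) :
      (LieAlgebra.ad ℂ (GroupLieAlgebra 𝓘(ℂ, E) G) (adjointAction g Y) ^ m) (adjointAction g w) =
        adjointAction g ((LieAlgebra.ad ℂ (GroupLieAlgebra 𝓘(ℂ, E) G) Y ^ m) w) := by
    induction m generalizing w with
    | zero => rfl
    | succ m ih =>
      rw [pow_succ, pow_succ, Module.End.mul_apply, Module.End.mul_apply, LieAlgebra.ad_apply,
        ← adjointAction_lie, ih, LieAlgebra.ad_apply]
  rw [← adjointAction_apply_inv_apply g w, h, hn]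
  simp

theorem adjointAction_mem_adjointOrbit (g : G) {X Y : GroupLieAlgebra 𝓘(ℂ, E) G}
    (hY : Y ∈ adjointOrbit X) : adjointAction g Y ∈ adjointOrbit X := by
  obtain ⟨a, rfl⟩ := hY
  exact ⟨g * a, adjointAction_mul_apply g a X⟩

theorem adjointAction_mem_closure_adjointOrbit (g : G) {X Y : GroupLieAlgebra 𝓘(ℂ, E) G}
    (hY : Y ∈ closure (adjointOrbit X)) : adjointAction g Y ∈ closure (adjointOrbit X) :=
  map_mem_closure (adjointAction g).continuous hY fun _ h => adjointAction_mem_adjointOrbit g h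

variable (E G) in
/-- The linear form attached to a vector by the Killing form. -/
def killingMap : GroupLieAlgebra 𝓘(ℂ, E) G →ₗ[ℂ] (GroupLieAlgebra 𝓘(ℂ, E) G →L[ℂ] ℂ) :=
  (LinearMap.toContinuousLinearMap :
    (GroupLieAlgebra 𝓘(ℂ, E) G →ₗ[ℂ] ℂ) ≃ₗ[ℂ] (GroupLieAlgebra 𝓘(ℂ, E) G →L[ℂ] ℂ)).toLinearMap ∘ₗ
    killingForm ℂ (GroupLieAlgebra 𝓘(ℂ, E) G)

theorem killingMap_apply (X Y : GroupLieAlgebra 𝓘(ℂ, E) G) :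
    killingMap E G X Y = killingForm ℂ (GroupLieAlgebra 𝓘(ℂ, E) G) X Y := rfl

theorem mem_killingDual {O : Set (GroupLieAlgebra 𝓘(ℂ, E) G)}
    {ν : GroupLieAlgebra 𝓘(ℂ, E) G →L[ℂ] ℂ} :
    ν ∈ killingDual O ↔ ∃ X ∈ O, killingMap E G X = ν :=
  ⟨fun ⟨X, hX, h⟩ => ⟨X, hX, ContinuousLinearMap.ext fun Y => (h Y).symm⟩,
    fun ⟨X, hX, h⟩ => ⟨X, hX, fun Y => by rw [← h, killingMap_apply]⟩⟩

theorem coadjointAction_killingMap (g : G) (X : GroupLieAlgebra 𝓘(ℂ, E) G) :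
    coadjointAction g (killingMap E G X) = killingMap E G (adjointAction g X) := by
  ext Y
  change killingMap E G X (adjointAction g⁻¹ Y) = _
  rw [killingMap_apply, killingMap_apply, ← killingForm_adjointAction g,
    adjointAction_apply_inv_apply]

theorem coadjointAction_lie (g : G) (ν : GroupLieAlgebra 𝓘(ℂ, E) G →L[ℂ] ℂ)
    (X Y : GroupLieAlgebra 𝓘(ℂ, E) G) :
    coadjointAction g ν ⁅adjointAction (E := E) g X, adjointAction (E := E) g Y⁆ = ν ⁅X, Y⁆ := by
  rw [← adjointAction_lie]
  change ν (adjointAction g⁻¹ (adjointAction g ⁅X, Y⁆)) = _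
  rw [adjointAction_inv_apply_apply]

theorem finrank_quotient_coadjointStabilizer (g : G) (ν : GroupLieAlgebra 𝓘(ℂ, E) G →L[ℂ] ℂ) :
    Module.finrank ℂ (GroupLieAlgebra 𝓘(ℂ, E) G ⧸
      coadjointStabilizer (coadjointAction g ν).toLinearMap) =
    Module.finrank ℂ (GroupLieAlgebra 𝓘(ℂ, E) G ⧸ coadjointStabilizer ν.toLinearMap) := by
  refine (Submodule.Quotient.equiv _ _ (adjointLieEquiv (E := E) g).toLinearEquiv ?_).finrank_eq.symm
  ext X
  constructor
  · rintro ⟨Y, hY, rfl⟩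
    refine LinearMap.mem_ker.2 (LinearMap.ext fun Z => ?_)
    have h1 := coadjointAction_lie g ν Y (adjointAction g⁻¹ Z)
    rw [adjointAction_apply_inv_apply] at h1
    exact h1.trans (LinearMap.congr_fun (LinearMap.mem_ker.1 hY) (adjointAction g⁻¹ Z))
  · intro hX
    refine ⟨adjointAction g⁻¹ X, LinearMap.mem_ker.2 (LinearMap.ext fun Z => ?_),
      adjointAction_apply_inv_apply g X⟩
    have h1 := coadjointAction_lie g ν (adjointAction g⁻¹ X) Z
    rw [adjointAction_apply_inv_apply] at h1
    exact h1.symm.trans (LinearMap.congr_fun (LinearMap.mem_ker.1 hX) (adjointAction g Z))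

theorem contMDiff_det_killingMap (Y : GroupLieAlgebra 𝓘(ℂ, E) G) {r : ℕ}
    (w : Fin r → Fin r → GroupLieAlgebra 𝓘(ℂ, E) G) :
    ContMDiff 𝓘(ℂ, E) 𝓘(ℂ, ℂ) ω fun g : G =>
      (Matrix.of fun i j => killingMap E G (adjointAction g Y) (w i j)).det := by
  let f (i j : Fin r) : E →L[ℂ] ℂ := killingMap E G (w i j)
  have hF : ContDiff ℂ ω fun x : E => (Matrix.of fun i j => f i j x).det := by
    simp only [Matrix.det_apply]
    refine ContDiff.sum fun σ _ => ContDiff.const_smul _ (contDiff_prod fun i _ => ?_)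
    exact (f _ _).contDiff
  have h := hF.contMDiff.comp (contMDiff_adjointAction_apply (G := G) (E := E) Y)
  have heq : (fun g : G => (Matrix.of fun i j => killingMap E G (adjointAction g Y) (w i j)).det) =
      (fun x : E => (Matrix.of fun i j => f i j x).det) ∘ fun g : G => adjointOne g (Y : E) := by
    ext g
    refine congrArg Matrix.det (Matrix.ext fun i j => ?_)
    exact LieModule.traceForm_comm ℂ _ _ _ _
  rw [heq]
  exact h

/-- If `L = 𝔨 + Z(ν) + ℂ Q` for the linear form `ν` corresponding to some `Y` in the orbit, then
the coadjoint action of `K` on the orbit is coisotropic. -/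
theorem isCoisotropicCoadjointAction_of_lie_le [ConnectedSpace G] (K : Subgroup G)
    {Y Q : GroupLieAlgebra 𝓘(ℂ, E) G}
    (hQ : ∀ Z : GroupLieAlgebra 𝓘(ℂ, E) G, ∃ k ∈ subgroupLieAlgebra (E := E) K, ∃ c : ℂ,
      Z - (k + c • Q) ∈ coadjointStabilizer (killingMap E G Y).toLinearMap) :
    IsCoisotropicCoadjointAction K (killingDual (adjointOrbit Y)) := by
  set d := Module.finrank ℂ (GroupLieAlgebra 𝓘(ℂ, E) G ⧸
    coadjointStabilizer (killingMap E G Y).toLinearMap) with hd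
  obtain ⟨k, W, hk, hdet⟩ := exists_det_ne_zero hQ (r := d - 1) rfl
  -- All choices of rows in Lie(`K`) and of columns are allowed, which makes `V` stable under `K`:
  -- conjugating both moves a nonzero minor along the orbit.
  set V : Set (GroupLieAlgebra 𝓘(ℂ, E) G →L[ℂ] ℂ) :=
    {ν | ∃ k W : Fin (d - 1) → GroupLieAlgebra 𝓘(ℂ, E) G,
      (∀ i, k i ∈ subgroupLieAlgebra (E := E) K) ∧
        (Matrix.of fun i j => ν ⁅k i, W j⁆).det ≠ 0} with hV
  have hOg {ν : GroupLieAlgebra 𝓘(ℂ, E) G →L[ℂ] ℂ} (hν : ν ∈ killingDual (adjointOrbit Y)) :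
      ∃ g : G, killingMap E G (adjointAction g Y) = ν := by
    obtain ⟨_, ⟨g, rfl⟩, h⟩ := mem_killingDual.1 hν
    exact ⟨g, h⟩
  refine ⟨killingDual (adjointOrbit Y) ∩ V, ?_, ⟨V, ?_, rfl⟩, ?_, ?_⟩
  · rintro h hh ν ⟨hνO, k, W, hk, hdet⟩
    refine ⟨?_, fun i => adjointAction h (k i), fun i => adjointAction h (W i),
      fun i => adjointAction_mem_subgroupLieAlgebra hh (hk i), ?_⟩
    · obtain ⟨g, rfl⟩ := hOg hνO
      rw [coadjointAction_killingMap]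
      exact mem_killingDual.2 ⟨_, adjointAction_mem_adjointOrbit h ⟨g, rfl⟩, rfl⟩
    · simpa only [coadjointAction_lie] using hdet
  · have : V = ⋃ (k : Fin (d - 1) → GroupLieAlgebra 𝓘(ℂ, E) G)
        (W : Fin (d - 1) → GroupLieAlgebra 𝓘(ℂ, E) G)
        (_ : ∀ i, k i ∈ subgroupLieAlgebra (E := E) K),
        {ν : GroupLieAlgebra 𝓘(ℂ, E) G →L[ℂ] ℂ |
          (Matrix.of fun i j => ν ⁅k i, W j⁆).det ≠ 0} := by
      ext ν; simp [hV]
    rw [this]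
    refine isOpen_iUnion fun k => isOpen_iUnion fun W => isOpen_iUnion fun _ => ?_
    refine isOpen_ne_fun (Continuous.matrix_det (continuous_matrix fun i j => ?_)) continuous_const
    exact continuous_eval_const _
  · intro ν hν
    obtain ⟨g₀, rfl⟩ := hOg hν
    -- The single minor found at `Y`, pulled back along the orbit map, is holomorphic on `G` and
    -- nonzero at 1.
    have hdense := dense_ne_zero_of_contMDiff (x₀ := (1 : G))
      (contMDiff_det_killingMap (E := E) (G := G) Y fun i j => ⁅k i, W j⁆)
      (by simpa only [adjointAction_one_apply, ContinuousLinearMap.coe_coe] using hdet)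
    have hcont : Continuous fun g : G => killingMap E G (adjointAction g Y) :=
      (killingMap E G).continuous_of_finiteDimensional.comp
        (contMDiff_adjointAction_apply (G := G) (E := E) Y).continuous
    refine map_mem_closure (f := fun g : G => killingMap E G (adjointAction g Y)) hcont (hdense g₀)
      fun g hg => ⟨?_, k, W, hk, hg⟩
    exact mem_killingDual.2 ⟨_, ⟨g, rfl⟩, rfl⟩
  · rintro ν ⟨hνO, k, W, hk, hdet⟩
    refine isCoisotropicSubspace_of_det_ne_zero ?_ hk hdet
    obtain ⟨g, rfl⟩ := hOg hνO
    rw [← coadjointAction_killingMap, finrank_quotient_coadjointStabilizer]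
    omega

end Assembly

end

theorem mainTheorem9 {E : Type*} [NormedAddCommGroup E] [NormedSpace ℂ E]
    [FiniteDimensional ℂ E] [CompleteSpace E]
    {G : Type*} [TopologicalSpace G] [ChartedSpace E G] [Group G]
    [LieGroup 𝓘(ℂ, E) ω G] [ConnectedSpace G]
    [LieAlgebra.IsSimple ℂ (GroupLieAlgebra 𝓘(ℂ, E) G)]
    (θ : G →* G) (hθ : ContMDiff 𝓘(ℂ, E) 𝓘(ℂ, E) ω θ) (hinv : Function.Involutive θ)
    (K : Subgroup G) (hK : ∀ g ∈ K, θ g = g)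
    (hK₀ : connectedComponentIn {g : G | θ g = g} 1 ⊆ (K : Set G))
    (gR : LieSubalgebra ℝ (GroupLieAlgebra 𝓘(ℂ, E) G)) (hgR : IsRealForm gR)
    (hcartan : RestrictsToCartanInvolution (lieDifferential (E := E) θ) gR)
    (O : Set (GroupLieAlgebra 𝓘(ℂ, E) G)) (hO : IsMinimalOrbitMeeting gR O) :
    IsCoisotropicCoadjointAction K (killingDual O) := by
  obtain ⟨⟨X, ⟨hXnil, X₁, ⟨g, hg⟩, hX₁⟩, hX0, rfl⟩, hmin⟩ := hO
  have hg' : adjointAction g X = X₁ := hg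
  have hX₁0 : X₁ ≠ 0 := by
    rintro rfl
    apply hX0
    rw [← adjointAction_inv_apply_apply g X, hg', map_zero]
  have hnil : ∀ Y ∈ closure (adjointOrbit X),
      Y ∈ nilpotentCone (GroupLieAlgebra 𝓘(ℂ, E) G) := by
    refine closure_minimal ?_ isClosed_nilpotentCone
    rintro _ ⟨a, rfl⟩
    exact adjointAction_mem_nilpotentCone a hXnil
  let τ : GroupLieAlgebra 𝓘(ℂ, E) G →ₗ⁅ℂ⁆ GroupLieAlgebra 𝓘(ℂ, E) G :=
    { toFun := lieDifferential θ
      map_add' := map_add _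
      map_smul' := map_smul _
      map_lie' := lieDifferential_lie hθ hθ hinv hinv _ _ }
  have hτ (x : GroupLieAlgebra 𝓘(ℂ, E) G) : τ (τ x) = x := by
    have := lieDifferential_comp_apply (E := E) hθ hθ x
    rw [show θ.comp θ = MonoidHom.id G from MonoidHom.ext hinv, lieDifferential_id_apply] at this
    exact this.symm
  have hstable : ∀ (g : G), ∀ Y ∈ closure (adjointOrbit X),
      adjointAction g Y ∈ closure (adjointOrbit X) :=
    fun g Y hY => adjointAction_mem_closure_adjointOrbit g hY
  obtain ⟨Y, hYC, hYR, hY0, hY⟩ := exists_mem_realForm_lie_le_fixed_sup_span τ hτ hgR hcartan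
    isClosed_closure hnil (exp_ad_sum_mem isClosed_closure hstable)
    (exists_ad_flow isClosed_closure hstable)
    (subset_closure ⟨g, hg⟩ : X₁ ∈ closure (adjointOrbit X)) hX₁ hX₁0
  -- `Y` is a nonzero nilpotent element of the real form in the closure of the orbit, so minimality
  -- applies.
  have hYorbit : adjointOrbit Y = adjointOrbit X := by
    refine hmin Y ⟨hnil Y hYC, Y, ⟨1, adjointAction_one_apply Y⟩, hYR⟩ hY0 ?_
    rintro _ ⟨a, rfl⟩
    exact hstable a Y hYC
  rw [← hYorbit]
  have hYY : ∃ Q : GroupLieAlgebra 𝓘(ℂ, E) G, ⁅Q, Y⁆ = Y :=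
    exists_lie_eq_self_of_isNilpotent_ad (hnil Y hYC)
  obtain ⟨Q, hQ⟩ := hYY
  -- Since [Q, Y] = Y, the relation [Z, Y] = [k, Y] + cY says that Z - (k + cQ) centralizes `Y`,
  -- that is, stabilizes the corresponding linear form.
  refine isCoisotropicCoadjointAction_of_lie_le K (Q := Q) fun Z => ?_
  obtain ⟨k, c, hk, hZ⟩ := hY Z
  refine ⟨k, mem_subgroupLieAlgebra_of_lieDifferential_eq hθ hinv hK₀ hk, c,
    LinearMap.mem_ker.2 (LinearMap.ext fun W => ?_)⟩
  have h0 : ⁅Y, Z - (k + c • Q)⁆ = 0 := by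
    rw [← lie_skew, sub_lie, add_lie, smul_lie, hQ, hZ]
    simp
  change killingMap E G Y ⁅Z - (k + c • Q), W⁆ = 0
  rw [killingMap_apply]
  refine (LieModule.traceForm_apply_lie_apply ℂ (GroupLieAlgebra 𝓘(ℂ, E) G)
    (GroupLieAlgebra 𝓘(ℂ, E) G) Y (Z - (k + c • Q)) W).symm.trans ?_
  rw [h0]
  simp
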